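/- **Setting.** Let $R$ be a commutative ring (for instance $\mathbb{C}$, or a polynomial ring in which $\alpha,\beta,\gamma$ are indeterminates), let $\alpha,\beta,\gamma\in R$, let $n\ge 1$, and let $\lambda=(\lambda_1\ge\lambda_2\ge\dots\ge\lambda_n\ge 0)$ be an integer partition and $w\in S_n$ a permutation. Write $\boldsymbol{x}=(x_1,\dots,x_n)$. **Twisted Kirillov polynomials.** For $1\le i<n$ and $f\in R[x_1,\dots,x_n]$ put $$\partial_i f=\frac{f(x_1,\dots,x_{i-1},x_{i+1},x_i,x_{i+2},\dots,x_n)-f(x_1,\dots,x_n)}{x_{i+1}-x_i},$$ $$T_i=-\beta+\bigl((\alpha+\beta+\gamma)x_i+\gamma x_{i+1}+1+(\beta+\gamma)(\alpha+\gamma)x_ix_{i+1}\bigr)\partial_i .$$ For a reduced word $w=s_{i_1}s_{i_2}\cdots s_{i_\ell}$, where $s_i$ exchanges $i$ and $i+1$, put $$\mathcal{KN}_w^{(\beta,\alpha,\gamma)}(\boldsymbol{x};\lambda)=T_{i_1}T_{i_2}\cdots T_{i_\ell}\bigl(x_1^{d_1}\cdots x_n^{d_n}\bigr),\qquad d_i=\lambda_1-\lambda_{n+1-i}+n-i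 .$$ **Lattice model.** Take a grid with rows $1,\dots,n$ from top to bottom and columns $N,N-1,\dots,0$ from left to right. Row $i$ has spectral parameter $x_i$. Horizontal edges are labeled by elements of $\{+,1,\dots,n\}$ and vertical edges by subsets of $\{1,\dots,n\}$. For $\Sigma\subseteq\{1,\dots,n\}$ and a color $c$ let $\Sigma_{>c}=\{s\in\Sigma:s>c\}$; let $x\oplus_{u,\gamma}1=1+(u+\gamma)x$; let $h_k=\sum_{i+j=k}\alpha^i\beta^j$ for $k\ge 0$ and $h_{-1}=0$. A vertex in a row with spectral parameter $x$, with northern label $\Sigma$, has the following Boltzmann weight, where $c\ne d$ denote colors: * west $+$, east $+$, south $\Sigma$: $\;(-1)^{|\Sigma|}\bigl(\beta^{|\Sigma|}-(\beta+\gamma)\,h_{|\Sigma|-1}\,(x\oplus_{\alpha,\gamma}1)\bigr)$; * west $c$, east $c$, south $\Sigma$: $\;(x\oplus_{\alpha+\beta,\gamma}1)(\alpha\beta)^{|\Sigma_{>c}|}$ if $c\in\Sigma$, and $x\,(\alpha\beta)^{|\Sigma_{>c}|}$ if $c\notin\Sigma$; * west $+$, east $c\notin\Sigma$, south $\Sigma\cup\{c\}$: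 $\;(-\alpha)^{|\Sigma_{>c}|}(x\oplus_{\alpha,\gamma}1)(x\oplus_{\beta,\gamma}1)$; * west $c\in\Sigma$, east $+$, south $\Sigma\setminus\{c\}$: $\;(-1)^{|\Sigma|-1}(-\beta)^{|\Sigma_{>c}|}\bigl(\beta^{|\Sigma|-1}-(\beta+\gamma)\,h_{|\Sigma|-2}\bigr)$; * west $c\in\Sigma$, east $d\notin\Sigma$, south $\Sigma'=(\Sigma\cup\{d\})\setminus\{c\}$: $\;(-\alpha)^{|\Sigma_{>d}|}(-\beta)^{|\Sigma_{>c}|}(x\oplus_{\alpha,\gamma}1)$ if $c<d$, and $(-\alpha)^{|\Sigma'_{>d}|}(-\beta)^{|\Sigma_{>c}|}(x\oplus_{\beta,\gamma}1)$ if $c>d$; * every other vertex has weight $0$. A state is a labeling of all edges; its weight is the product of the weights of all vertices. The partition function for a given labeling of the boundary edges is the sum of the weights of all states with these boundary labels. Let $N=\lambda_1+n-1$, so that the grid has $\lambda_1+n$ columns. Let $\mathfrak{S}_w^\lambda$ be the system with the following boundary labels. The left edge of row $i$ carries $n+1-w^{-1}(i)$. The top edge of column $j$ carries the set of all $i$ with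 $\lambda_i+n-i=j$ (the boundary condition for the long permutation $w_0$ and the partition $\lambda+\rho$, $\rho=(n-1,\dots,1,0)$). All right edges carry $+$, and all bottom edges carry $\varnothing$. **Theorem.** The polynomial $\mathcal{KN}_w^{(\beta,\alpha,\gamma)}(\boldsymbol{x};\lambda)$ does not depend on the choice of the reduced word of $w$, and $$Z(\mathfrak{S}_w^\lambda)=\mathcal{KN}_w^{(\beta,\alpha,\gamma)}(\boldsymbol{x};\lambda).$$ -/

import Mathlib

namespace KirillovModel

/-! ## Divided differences and Kirillov's operators -/

section Operators

open MvPolynomial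

variable {m : ℕ} {R : Type*} [CommRing R]

/-- The simple transposition exchanging two neighbouring indices. -/
def simpleTransposition (i : Fin m) : Equiv.Perm (Fin (m + 1)) :=
  Equiv.swap i.castSucc i.succ

/-- The action `f ↦ f(x₁, …, x_{i+1}, x_i, …, xₙ)` of a simple transposition on polynomials. -/
noncomputable def swapVars (i : Fin m) (f : MvPolynomial (Fin (m + 1)) R) :
    MvPolynomial (Fin (m + 1)) R :=
  rename (simpleTransposition i) f

theorem dvd_swapVars_sub (i : Fin m) (f : MvPolynomial (Fin (m + 1)) R) :
    (X i.succ - X i.castSucc : MvPolynomial (Fin (m + 1)) R) ∣ swapVars i f - f := by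
  induction f using MvPolynomial.induction_on with
  | C a => simp [swapVars]
  | add p q hp hq =>
    have h : swapVars i (p + q) - (p + q) = (swapVars i p - p) + (swapVars i q - q) := by
      simp only [swapVars, map_add]; ring
    rw [h]
    exact dvd_add hp hq
  | mul_X p j hp =>
    have h : swapVars i (p * X j) - p * X j =
        swapVars i p * (X (simpleTransposition i j) - X j) + (swapVars i p - p) * X j := by
      simp only [swapVars, map_mul, rename_X]; ring
    rw [h]
    refine dvd_add (Dvd.dvd.mul_left ?_ _) (Dvd.dvd.mul_right hp _)
    unfold simpleTransposition
    by_cases h1 : j = i.castSucc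
    · subst h1
      rw [Equiv.swap_apply_left]
    · by_cases h2 : j = i.succ
      · subst h2
        rw [Equiv.swap_apply_right]
        exact ⟨-1, by ring⟩
      · rw [Equiv.swap_apply_of_ne_of_ne h1 h2, sub_self]
        exact dvd_zero _

/-- The divided difference `∂ᵢ f = (f(…, x_{i+1}, x_i, …) - f) / (x_{i+1} - x_i)`, that is, the
polynomial quotient; it exists by `dvd_swapVars_sub` and is unique by `dividedDifference_unique`. -/
noncomputable def dividedDifference (i : Fin m) (f : MvPolynomial (Fin (m + 1)) R) :
    MvPolynomial (Fin (m + 1)) R :=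
  (dvd_swapVars_sub i f).choose

theorem mul_dividedDifference (i : Fin m) (f : MvPolynomial (Fin (m + 1)) R) :
    (X i.succ - X i.castSucc) * dividedDifference i f = swapVars i f - f :=
  (dvd_swapVars_sub i f).choose_spec.symm

theorem isLeftRegular_X_sub_X (i : Fin m) :
    IsLeftRegular (X i.succ - X i.castSucc : MvPolynomial (Fin (m + 1)) R) := by
  have hne : i.castSucc ≠ i.succ := (Fin.castSucc_lt_succ).ne
  let φ : MvPolynomial (Fin (m + 1)) R →ₐ[R] MvPolynomial (Fin (m + 1)) R :=
    aeval fun k => if k = i.succ then X k + X i.castSucc else X k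
  let ψ : MvPolynomial (Fin (m + 1)) R →ₐ[R] MvPolynomial (Fin (m + 1)) R :=
    aeval fun k => if k = i.succ then X k - X i.castSucc else X k
  have hψφ : ψ.comp φ = AlgHom.id R _ := by
    apply MvPolynomial.algHom_ext
    intro k
    by_cases hk : k = i.succ
    · subst hk
      simp [φ, ψ, hne]
    · simp [φ, ψ, hk]
  have hφ : φ (X i.succ - X i.castSucc) = X i.succ := by
    simp [φ, hne]
  intro a b hab
  have h1 : X i.succ * φ a = X i.succ * φ b := by
    have := congrArg φ hab
    simpa only [map_mul, hφ] using this
  have h2 : φ a = φ b := (isRegular_X).left h1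
  have h3 := congrArg ψ h2
  have e : ∀ p, ψ (φ p) = p := fun p => DFunLike.congr_fun hψφ p
  rwa [e, e] at h3

theorem dividedDifference_unique (i : Fin m) (f g : MvPolynomial (Fin (m + 1)) R)
    (h : (X i.succ - X i.castSucc) * g = swapVars i f - f) : g = dividedDifference i f :=
  isLeftRegular_X_sub_X i (h.trans (mul_dividedDifference i f).symm)

/-- Kirillov's operator
`Tᵢ = -β + ((α + β + γ) xᵢ + γ xᵢ₊₁ + 1 + (β + γ)(α + γ) xᵢ xᵢ₊₁) ∂ᵢ`. -/
noncomputable def kirillovOp (β α γ : R) (i : Fin m) (f : MvPolynomial (Fin (m + 1)) R) :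
    MvPolynomial (Fin (m + 1)) R :=
  -C β * f +
    (C (α + β + γ) * X i.castSucc + C γ * X i.succ + 1
      + C ((β + γ) * (α + γ)) * X i.castSucc * X i.succ) * dividedDifference i f

/-- The composite `T_{i₁} T_{i₂} ⋯ T_{i_ℓ}` attached to the word `[i₁, …, i_ℓ]`; the last letter
acts first. -/
noncomputable def kirillovWordOp (β α γ : R) (l : List (Fin m))
    (f : MvPolynomial (Fin (m + 1)) R) : MvPolynomial (Fin (m + 1)) R :=
  l.foldr (kirillovOp β α γ) f

/-- The permutation `s_{i₁} s_{i₂} ⋯ s_{i_ℓ}` spelled by a word. -/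
def wordPerm (l : List (Fin m)) : Equiv.Perm (Fin (m + 1)) :=
  (l.map simpleTransposition).prod

/-- `l` is a reduced word of `w`: it spells `w`, and no shorter word does. -/
def IsReducedWord (w : Equiv.Perm (Fin (m + 1))) (l : List (Fin m)) : Prop :=
  wordPerm l = w ∧ ∀ l' : List (Fin m), wordPerm l' = w → l.length ≤ l'.length

theorem exists_isReducedWord (w : Equiv.Perm (Fin (m + 1))) :
    ∃ l : List (Fin m), IsReducedWord w l := by
  have hw : ∃ l : List (Fin m), wordPerm l = w := by
    have h : w ∈ Submonoid.closure
        (Set.range fun i : Fin m => Equiv.swap i.castSucc i.succ) := by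
      rw [Equiv.Perm.mclosure_swap_castSucc_succ]
      trivial
    induction h using Submonoid.closure_induction with
    | mem x hx =>
      obtain ⟨i, rfl⟩ := hx
      exact ⟨[i], by simp [wordPerm, simpleTransposition]⟩
    | one => exact ⟨[], by simp [wordPerm]⟩
    | mul x y _ _ hx hy =>
      obtain ⟨a, rfl⟩ := hx
      obtain ⟨b, rfl⟩ := hy
      exact ⟨a ++ b, by simp [wordPerm]⟩
  have hw' : {l : List (Fin m) | wordPerm l = w}.Nonempty := hw
  exact ⟨Function.argminOn List.length _ hw', Function.argminOn_mem List.length _ hw',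
    fun l' hl' => Function.argminOn_le List.length _ hl'⟩

/-- The monomial `x₁^{d₁} ⋯ xₙ^{dₙ}` with `dᵢ = λ₁ - λ_{n+1-i} + n - i` (indices counted from `1`);
counted from `0`, `n + 1 - i` becomes `Fin.rev i` and `n - i` becomes the value of `Fin.rev i`. -/
noncomputable def seedMonomial (R : Type*) [CommRing R] (lam : Fin (m + 1) → ℕ) :
    MvPolynomial (Fin (m + 1)) R :=
  ∏ i : Fin (m + 1), X i ^ (lam 0 - lam i.rev + (i.rev : ℕ))

/-- The twisted Kirillov polynomial `KN_w^{(β,α,γ)}(x; λ)`, computed along some reduced word. -/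
noncomputable def twistedKirillov (β α γ : R) (w : Equiv.Perm (Fin (m + 1)))
    (lam : Fin (m + 1) → ℕ) : MvPolynomial (Fin (m + 1)) R :=
  kirillovWordOp β α γ (exists_isReducedWord w).choose (seedMonomial R lam)

end Operators

/-! ## The colored lattice model

Rows and colors are indexed by `Fin n`, in increasing order.  The columns of a grid with `N + 1`
columns are indexed by `Fin (N + 1)` and *decrease from left to right*, so column `0` is the
rightmost one.  A horizontal edge label is an `Option (Fin n)`, where `none` stands for `+`; a
vertical edge label is a finite set of colors. -/

section Lattice

/-- The complete homogeneous symmetric function `h_k(α, β) = ∑_{i + j = k} αⁱ βʲ`, equal to `0`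
for negative `k` (only `k ≥ -1` is used below). -/
def completeHomog {A : Type*} [CommRing A] (α β : A) (k : ℤ) : A :=
  if k < 0 then 0 else ∑ i ∈ Finset.range (k.toNat + 1), α ^ i * β ^ (k.toNat - i)

/-- `x ⊕_{u,γ} 1 = 1 + (u + γ) x`. -/
def oplusOne {A : Type*} [CommRing A] (u γ x : A) : A := 1 + (u + γ) * x

/-- The number of elements of `Σ` that are greater than `c`. -/
def numAbove {n : ℕ} (S : Finset (Fin n)) (c : Fin n) : ℕ := (S.filter fun s => c < s).card

/-- The Boltzmann weight of a vertex with spectral parameter `x` and the given labels on its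
western, northern, eastern and southern edges. -/
def boltzmannWeight {A : Type*} [CommRing A] {n : ℕ} (β α γ x : A)
    (west : Option (Fin n)) (north : Finset (Fin n))
    (east : Option (Fin n)) (south : Finset (Fin n)) : A :=
  match west, east with
  | none, none =>
      if south = north then
        (-1) ^ north.card *
          (β ^ north.card
            - (β + γ) * completeHomog α β ((north.card : ℤ) - 1) * oplusOne α γ x)
      else 0
  | none, some c =>
      if c ∉ north ∧ south = insert c north then
        (-α) ^ numAbove north c * oplusOne α γ x * oplusOne β γ x
      else 0
  | some c, none =>
      if c ∈ north ∧ south = north.erase c then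
        (-1) ^ (north.card - 1) * (-β) ^ numAbove north c *
          (β ^ (north.card - 1) - (β + γ) * completeHomog α β ((north.card : ℤ) - 2))
      else 0
  | some c, some d =>
      if c = d then
        if south = north then
          (if c ∈ north then oplusOne (α + β) γ x else x) * (α * β) ^ numAbove north c
        else 0
      else if c ∈ north ∧ d ∉ north ∧ south = (insert d north).erase c then
        if c < d then
          (-α) ^ numAbove north d * (-β) ^ numAbove north c * oplusOne α γ x
        else
          (-α) ^ numAbove south d * (-β) ^ numAbove north c * oplusOne β γ x
      else 0

/-- A state: labels of all edges of a grid with `n` rows and `N + 1` columns.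

* `s.1 i k` is the label of the `k`-th horizontal edge of row `i`, counted from the right: column
  `j` has edge `j.castSucc` on its east and edge `j.succ` on its west.
* `s.2 k j` is the label of the `k`-th vertical edge of column `j`, counted from the top: row
  `i` has edge `i.castSucc` on its north and edge `i.succ` on its south. -/
abbrev LatticeState (n N : ℕ) : Type :=
  (Fin n → Fin (N + 2) → Option (Fin n)) × (Fin (n + 1) → Fin (N + 1) → Finset (Fin n))

/-- The weight of a state: the product of the weights of all vertices; row `i` has spectral
parameter `x i`. -/
def stateWeight {A : Type*} [CommRing A] {n N : ℕ} (β α γ : A) (x : Fin n → A)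
    (s : LatticeState n N) : A :=
  ∏ i : Fin n, ∏ j : Fin (N + 1),
    boltzmannWeight β α γ (x i) (s.1 i j.succ) (s.2 i.castSucc j) (s.1 i j.castSucc) (s.2 i.succ j)

/-- Labels for all boundary edges of the grid. -/
structure BoundaryCondition (n N : ℕ) where
  left : Fin n → Option (Fin n)
  top : Fin (N + 1) → Finset (Fin n)
  right : Fin n → Option (Fin n)
  bottom : Fin (N + 1) → Finset (Fin n)

/-- The state `s` has boundary condition `B`. -/
def HasBoundary {n N : ℕ} (B : BoundaryCondition n N) (s : LatticeState n N) : Prop :=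
  (∀ i, s.1 i (Fin.last (N + 1)) = B.left i) ∧ (∀ j, s.2 0 j = B.top j) ∧
    (∀ i, s.1 i 0 = B.right i) ∧ (∀ j, s.2 (Fin.last n) j = B.bottom j)

open Classical in
/-- The partition function: the sum of the weights of all states with the given boundary
condition. -/
noncomputable def partitionFunction {A : Type*} [CommRing A] {n N : ℕ} (β α γ : A) (x : Fin n → A)
    (B : BoundaryCondition n N) : A :=
  ∑ s : LatticeState n N with HasBoundary B s, stateWeight β α γ x s

/-- The boundary condition determined by `w₁`, `w₂` and `μ`: row `i` carries `n + 1 - w₁⁻¹(i)` on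
the left, column `j` carries all `n + 1 - w₂⁻¹(i)` with `μᵢ = j` on top, and the right and bottom
boundary edges carry `+` and `∅`.  Counted from `0`, `c ↦ n + 1 - c` is `Fin.rev`. -/
def boundaryOf {n : ℕ} (N : ℕ) (w₁ w₂ : Equiv.Perm (Fin n)) (μ : Fin n → ℕ) :
    BoundaryCondition n N where
  left i := some (w₁⁻¹ i).rev
  top j := (Finset.univ.filter fun i => μ i = (j : ℕ)).image fun i => (w₂⁻¹ i).rev
  right _ := none
  bottom _ := ∅

/-- The boundary condition of the system `𝔖_w^λ`, with `n = m + 1` rows and `λ₁ + n` columns: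
it is determined by `w`, the long permutation `w₀ = Fin.revPerm`, and `λ + ρ`, where
`ρ = (n - 1, …, 1, 0)`. -/
def systemBoundary {m : ℕ} (w : Equiv.Perm (Fin (m + 1))) (lam : Fin (m + 1) → ℕ) :
    BoundaryCondition (m + 1) (lam 0 + m) :=
  boundaryOf (lam 0 + m) w Fin.revPerm fun i => lam i + (i.rev : ℕ)

end Lattice

end KirillovModel

/-! The engine is a Yang–Baxter equation. The R-matrix with entries `rDiag` and `rSwap` intertwines
two vertically adjacent vertices with parameters `x`, `y` (`yangBaxter`). Pushed through two
adjacent rows column by column (`twoRowWeight_exchange`), it arrives at the right edge, where both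
labels are `+` and it is the scalar `kirillovFactor`. With `K` this factor at `(xᵢ, xᵢ₊₁)` and `Z_w`
the partition function, the whole grid satisfies (`gridWeight_exchange`) `K · Z_w(sᵢ x) = rDiag ·
Z_w(x) + rSwap · Z_{sᵢ w}(x)`.

If `w⁻¹(i) < w⁻¹(i+1)`, the upper of the two left labels is the larger color, so `rSwap = xᵢ₊₁ - xᵢ`
and `rDiag = (1 + (α+γ) xᵢ)(1 + (β+γ) xᵢ₊₁) = K + β (xᵢ₊₁ - xᵢ)`. Solving for the last term and
cancelling `xᵢ₊₁ - xᵢ`, which is regular over every commutative ring, gives `Z_{sᵢ w} = Tᵢ Z_w`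
(`partitionFunction_simpleTransposition_mul`).

By the exchange condition, the inequality holds at each letter of a reduced word
(`IsReducedWord.of_cons`). For `w = 1` there is a single state of nonzero weight, and its weight is
the seed monomial (`gridWeight_placement`). Induction on the word finishes the proof. As `Z_w` is
defined without a word, independence of the reduced word follows with no appeal to braid relations.
-/

namespace KirillovModel

/-! ### Vertex weights, conservation of colors, and the R-matrix. -/

section Weights

variable {A : Type*} [CommRing A] {n : ℕ}

/-- The southern label that conservation of colors forces at a vertex. -/
def southLabel (west : Option (Fin n)) (north : Finset (Fin n)) (east : Option (Fin n)) :
    Finset (Fin n) :=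
  match west, east with
  | none, none => north
  | none, some c => insert c north
  | some c, none => north.erase c
  | some c, some d => if c = d then north else (insert d north).erase c

/-- `h_{k-1}(α, β)`, indexed by natural numbers. -/
def homogPred (α β : A) : ℕ → A
  | 0 => 0
  | k + 1 => α * homogPred α β k + β ^ k

/-- Splitting off the term `i = 0` gives `h_k = α h_{k-1} + β^k`. In this recursive form the weights
before and after inserting a color are related polynomially, as the Yang–Baxter identities require.
-/
theorem completeHomog_natCast_sub_one (α β : A) (k : ℕ) :
    completeHomog α β ((k : ℤ) - 1) = homogPred α β k := by
  induction k with
  | zero => simp [completeHomog, homogPred]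
  | succ k ih =>
    rw [homogPred, ← ih]
    cases k with
    | zero => simp [completeHomog]
    | succ k =>
      have h1 : ¬ ((k + 1 + 1 : ℕ) : ℤ) - 1 < 0 := by push_cast; omega
      have h2 : ¬ ((k + 1 : ℕ) : ℤ) - 1 < 0 := by push_cast; omega
      have e1 : (((k + 1 + 1 : ℕ) : ℤ) - 1).toNat = k + 1 := by push_cast; omega
      have e2 : (((k + 1 : ℕ) : ℤ) - 1).toNat = k := by push_cast; omega
      rw [completeHomog, completeHomog, if_neg h1, if_neg h2, e1, e2, Finset.sum_range_succ',
        Finset.mul_sum]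
      congr 1
      · refine Finset.sum_congr rfl fun i _ => ?_
        rw [Nat.succ_sub_succ]; ring
      · simp

/-- The weight of the vertex with the given three labels whose southern label is `southLabel`. -/
def vertexWeight (β α γ x : A) (west : Option (Fin n)) (north : Finset (Fin n))
    (east : Option (Fin n)) : A :=
  match west, east with
  | none, none =>
      (-1) ^ north.card *
        (β ^ north.card - (β + γ) * homogPred α β north.card * oplusOne α γ x)
  | none, some c =>
      if c ∈ north then 0 else (-α) ^ numAbove north c * oplusOne α γ x * oplusOne β γ x
  | some c, none =>
      if c ∈ north then
        (-1) ^ (north.card - 1) * (-β) ^ numAbove north c *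
          (β ^ (north.card - 1) - (β + γ) * homogPred α β (north.card - 1))
      else 0
  | some c, some d =>
      if c = d then
        (if c ∈ north then oplusOne (α + β) γ x else x) *
          ((-α) ^ numAbove north c * (-β) ^ numAbove north c)
      else if c ∈ north then
        if d ∈ north then 0
        else if c < d then
          (-α) ^ numAbove north d * (-β) ^ numAbove north c * oplusOne α γ x
        else
          (-α) ^ numAbove (north.erase c) d * (-β) ^ numAbove north c * oplusOne β γ x
      else 0

theorem numAbove_insert {N : Finset (Fin n)} {c d : Fin n} (h : d ∉ N) :
    numAbove (insert d N) c = numAbove N c + if c < d then 1 else 0 := by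
  unfold numAbove
  rw [Finset.filter_insert]
  split_ifs with h1
  · rw [Finset.card_insert_of_notMem (by simp [h])]
  · rfl

/-- Three labels of a vertex force the fourth, so sums over inner vertical edges collapse to one
term. -/
theorem boltzmannWeight_eq_ite (β α γ x : A) (a : Option (Fin n)) (N : Finset (Fin n))
    (e : Option (Fin n)) (S : Finset (Fin n)) :
    boltzmannWeight β α γ x a N e S =
      if S = southLabel a N e then vertexWeight β α γ x a N e else 0 := by
  rcases a with _ | c <;> rcases e with _ | d
  · by_cases hS : S = N <;>
      simp [boltzmannWeight, southLabel, vertexWeight, completeHomog_natCast_sub_one, hS]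
  · simp only [boltzmannWeight, southLabel, vertexWeight]
    by_cases hd : d ∈ N <;> simp [hd]
  · simp only [boltzmannWeight, southLabel, vertexWeight]
    by_cases hc : c ∈ N
    · have hk : 1 ≤ N.card := Finset.card_pos.2 ⟨c, hc⟩
      have : (N.card : ℤ) - 2 = ((N.card - 1 : ℕ) : ℤ) - 1 := by omega
      rw [this, completeHomog_natCast_sub_one]
      simp [hc]
    · simp [hc]
  · simp only [boltzmannWeight, southLabel, vertexWeight]
    by_cases hcd : c = d
    · simp [hcd, ← mul_pow]
    · by_cases hc : c ∈ N
      · by_cases hd : d ∈ N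
        · simp [hcd, hc, hd]
        · simp only [hcd, hc, hd, if_false, if_true, not_false_eq_true, true_and]
          by_cases hS : S = (insert d N).erase c
          · subst hS
            rcases lt_or_gt_of_ne hcd with h | h
            · simp [h]
            · simp only [if_true, if_neg h.not_gt]
              -- The exponent counts colors of the southern label above `d`; since `d` is not above
              -- itself, it may be left out of the set.
              rw [Finset.erase_insert_of_ne (Ne.symm hcd),
                numAbove_insert (by simp [hd])]
              simp
          · simp [hS]
      · simp [hcd, hc]

/-- How often the color `c` occurs in a horizontal label. -/
def labelCount (a : Option (Fin n)) (c : Fin n) : ℕ := if a = some c then 1 else 0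

/-- How often the color `c` occurs in a vertical label. -/
def memCount (S : Finset (Fin n)) (c : Fin n) : ℕ := if c ∈ S then 1 else 0

/-- Inserting a color already present, or erasing an absent one, would violate the count; exactly
those vertices have weight `0`. -/
theorem vertexWeight_conservation {β α γ x : A} {a e : Option (Fin n)} {N : Finset (Fin n)}
    (h : vertexWeight β α γ x a N e ≠ 0) (c : Fin n) :
    memCount N c + labelCount e c = memCount (southLabel a N e) c + labelCount a c := by
  unfold memCount labelCount
  rcases a with _ | a <;> rcases e with _ | e <;>
    simp only [vertexWeight, southLabel] at h ⊢
  · rfl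
  · by_cases he : e ∈ N
    · simp [he] at h
    · by_cases hc : e = c
      · subst hc; simp [he]
      · simp [hc, Ne.symm hc]
  · by_cases he : a ∈ N
    · by_cases hc : a = c
      · subst hc; simp [he]
      · simp [hc, Ne.symm hc]
    · simp [he] at h
  · by_cases hae : a = e
    · simp [hae]
    · by_cases ha : a ∈ N
      · by_cases he : e ∈ N
        · simp [hae, ha, he] at h
        · by_cases hc : a = c
          · subst hc; simp [ha, hae, Ne.symm hae]
          · by_cases hc' : e = c
            · subst hc'; simp [he, hc, Ne.symm hc]
            · simp [hc, hc', hae, Ne.symm hc, Ne.symm hc']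
      · simp [hae, ha] at h

/-- The weight of two vertically adjacent vertices with spectral parameters `x` (above) and `y`,
summed over the label of the edge between them. -/
def pairWeight (β α γ x y : A) (a b : Option (Fin n)) (e f : Option (Fin n))
    (N S : Finset (Fin n)) : A :=
  ∑ M, boltzmannWeight β α γ x a N e M * boltzmannWeight β α γ y b M f S

theorem pairWeight_eq (β α γ x y : A) (a b e f : Option (Fin n)) (N S : Finset (Fin n)) :
    pairWeight β α γ x y a b e f N S =
      if S = southLabel b (southLabel a N e) f then
        vertexWeight β α γ x a N e * vertexWeight β α γ y b (southLabel a N e) f else 0 := by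
  rw [pairWeight, Finset.sum_eq_single (southLabel a N e)]
  · rw [boltzmannWeight_eq_ite, if_pos rfl, boltzmannWeight_eq_ite, mul_ite, mul_zero]
  · intro M _ hM
    rw [boltzmannWeight_eq_ite, if_neg hM, zero_mul]
  · simp

/-- Conservation of colors for two vertically adjacent vertices. -/
def Conserved (a b e f : Option (Fin n)) (N S : Finset (Fin n)) : Prop :=
  ∀ c, memCount N c + labelCount e c + labelCount f c =
    memCount S c + labelCount a c + labelCount b c

theorem memCount_injective : Function.Injective (memCount (n := n)) := by
  intro S T h
  ext c
  have := congrFun h c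
  unfold memCount at this
  split_ifs at this <;> simp_all

theorem pairWeight_eq_zero (β α γ x y : A) {a b e f : Option (Fin n)} {N S : Finset (Fin n)}
    (h : ¬ Conserved a b e f N S) : pairWeight β α γ x y a b e f N S = 0 := by
  rw [pairWeight_eq]
  split_ifs with hS
  · by_contra hne
    refine h fun c => ?_
    have h1 := vertexWeight_conservation (left_ne_zero_of_mul hne) c
    have h2 := vertexWeight_conservation (right_ne_zero_of_mul hne) c
    rw [hS]; omega
  · rfl

/-- The condition on the southern label is redundant here: if both vertex weights are nonzero,
conservation at each vertex forces the multiplicity of every color in `S`. -/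
theorem pairWeight_eq_of_conserved (β α γ x y : A) {a b e f : Option (Fin n)}
    {N S : Finset (Fin n)} (h : Conserved a b e f N S) :
    pairWeight β α γ x y a b e f N S =
      vertexWeight β α γ x a N e * vertexWeight β α γ y b (southLabel a N e) f := by
  rw [pairWeight_eq]
  split_ifs with hS
  · rfl
  · by_contra hne
    apply hS
    apply memCount_injective
    funext c
    have h1 := vertexWeight_conservation (left_ne_zero_of_mul (Ne.symm hne)) c
    have h2 := vertexWeight_conservation (right_ne_zero_of_mul (Ne.symm hne)) c
    have h3 := h c
    omega

theorem Conserved.swap_west {a b e f : Option (Fin n)} {N S : Finset (Fin n)}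
    (h : Conserved a b e f N S) : Conserved b a e f N S := fun c => by
  have := h c; omega

theorem Conserved.swap_east {a b e f : Option (Fin n)} {N S : Finset (Fin n)}
    (h : Conserved a b e f N S) : Conserved a b f e N S := fun c => by
  have := h c; omega

/-- The polynomial `(α + β + γ) x + γ y + 1 + (β + γ)(α + γ) x y`. -/
def kirillovFactor (β α γ x y : A) : A :=
  (α + β + γ) * x + γ * y + 1 + (β + γ) * (α + γ) * x * y

/-- The diagonal entries of the R-matrix. -/
def rDiag (β α γ x y : A) (a b : Option (Fin n)) : A :=
  match a, b with
  | none, none => kirillovFactor β α γ x y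
  | none, some _ => oplusOne α γ y * oplusOne β γ y
  | some _, none => oplusOne α γ x * oplusOne β γ x
  | some c, some d =>
      if c = d then kirillovFactor β α γ y x
      else if c < d then oplusOne β γ x * oplusOne α γ y
      else oplusOne α γ x * oplusOne β γ y

/-- The off-diagonal entries of the R-matrix. -/
def rSwap (β α x y : A) (a b : Option (Fin n)) : A :=
  match a, b with
  | none, none => 0
  | none, some _ => α * β * (y - x)
  | some _, none => y - x
  | some c, some d => if c = d then 0 else if c < d then α * β * (y - x) else y - x

end Weights

/-! ### The Yang–Baxter equation as polynomial identities, by number of colors. -/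

section YangBaxter

variable {A : Type*} [CommRing A] {n : ℕ}

/-- The Yang–Baxter equation for one column, with the southern labels eliminated. -/
def YangBaxterAt (β α γ x y : A) (N : Finset (Fin n)) (a b e f : Option (Fin n)) : Prop :=
  rDiag β α γ x y a b *
        (vertexWeight β α γ x a N e * vertexWeight β α γ y b (southLabel a N e) f)
      + rSwap β α x y a b *
        (vertexWeight β α γ x b N e * vertexWeight β α γ y a (southLabel b N e) f)
    = (vertexWeight β α γ y a N e * vertexWeight β α γ x b (southLabel a N e) f)
        * rDiag β α γ x y e f
      + (vertexWeight β α γ y a N f * vertexWeight β α γ x b (southLabel a N f) e)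
        * rSwap β α x y f e

theorem lt_and_not_gt_or {c d : Fin n} (h : c ≠ d) : (c < d ∧ ¬ d < c) ∨ (d < c ∧ ¬ c < d) := by
  rcases lt_or_gt_of_ne h with h | h
  · exact Or.inl ⟨h, h.not_gt⟩
  · exact Or.inr ⟨h, h.not_gt⟩

/-- The case of the Yang–Baxter equation with no color on the horizontal edges. -/
theorem yangBaxterAt_zero (β α γ x y : A) (N : Finset (Fin n)) :
    YangBaxterAt β α γ x y N none none none none := by
  simp only [YangBaxterAt, vertexWeight, southLabel, rDiag, rSwap, oplusOne, kirillovFactor]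
  ring

set_option linter.unusedSimpArgs false in
set_option maxHeartbeats 4000000 in
/-- The cases of the Yang–Baxter equation with one color on the horizontal edges. -/
theorem yangBaxterAt_one (β α γ x y : A) {N : Finset (Fin n)} {c : Fin n} (hc : c ∉ N) :
    (YangBaxterAt β α γ x y (insert c N) (some c) none none none ∧
      YangBaxterAt β α γ x y (insert c N) none (some c) none none ∧
      YangBaxterAt β α γ x y N none none (some c) none ∧
      YangBaxterAt β α γ x y N none none none (some c)) ∧
    (∀ M, N = M ∨ insert c N = M →
      YangBaxterAt β α γ x y M (some c) none (some c) none ∧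
      YangBaxterAt β α γ x y M (some c) none none (some c) ∧
      YangBaxterAt β α γ x y M none (some c) (some c) none ∧
      YangBaxterAt β α γ x y M none (some c) none (some c)) ∧
    (YangBaxterAt β α γ x y N none (some c) (some c) (some c) ∧
      YangBaxterAt β α γ x y N (some c) none (some c) (some c) ∧
      YangBaxterAt β α γ x y (insert c N) (some c) (some c) none (some c) ∧
      YangBaxterAt β α γ x y (insert c N) (some c) (some c) (some c) none) ∧
    ∀ M, N = M ∨ insert c N = M →
      YangBaxterAt β α γ x y M (some c) (some c) (some c) (some c) := by
  refine ⟨⟨?_, ?_, ?_, ?_⟩, ?_, ⟨?_, ?_, ?_, ?_⟩, ?_⟩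
  all_goals try rintro M (rfl | rfl)
  all_goals try refine ⟨?_, ?_, ?_, ?_⟩
  all_goals
    simp only [hc,
      Finset.mem_insert, Finset.mem_erase, Finset.erase_insert_of_ne, Finset.erase_insert,
      Finset.card_insert_of_notMem, numAbove_insert, Nat.add_sub_cancel, homogPred, ne_eq,
      not_true_eq_false, not_false_eq_true, or_false, or_true, false_or, true_or, and_true,
      and_false, if_true, if_false, lt_self_iff_false, add_zero, pow_succ, pow_zero, mul_zero,
      zero_mul, YangBaxterAt, vertexWeight, southLabel, rDiag, rSwap, oplusOne,
      kirillovFactor]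
    -- The spectator colors `N` enter only through these powers and `homogPred`. Once `c` has been
    -- split off from the northern label, they can be treated as independent variables.
    generalize β ^ N.card = B
    generalize (-1 : A) ^ N.card = E
    generalize homogPred α β N.card = H
    generalize (-α) ^ numAbove N c = u0
    generalize (-β) ^ numAbove N c = v0
    ring1

set_option linter.unusedSimpArgs false in
set_option maxHeartbeats 4000000 in
/-- The cases of the Yang–Baxter equation with two colors on the horizontal edges. -/
theorem yangBaxterAt_two (β α γ x y : A) {N : Finset (Fin n)} {c d : Fin n} (hc : c ∉ N)
    (hd : d ∉ N) (hcd : c ≠ d) :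
    (YangBaxterAt β α γ x y N none none (some c) (some d) ∧
      YangBaxterAt β α γ x y (insert c (insert d N)) (some c) (some d) none none ∧
      YangBaxterAt β α γ x y (insert c N) none (some c) none (some d) ∧
      YangBaxterAt β α γ x y (insert c N) none (some c) (some d) none ∧
      YangBaxterAt β α γ x y (insert c N) (some c) none none (some d) ∧
      YangBaxterAt β α γ x y (insert c N) (some c) none (some d) none) ∧
    (∀ M, N = M ∨ insert c N = M →
      YangBaxterAt β α γ x y M none (some c) (some c) (some d) ∧
      YangBaxterAt β α γ x y M none (some c) (some d) (some c) ∧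
      YangBaxterAt β α γ x y M (some c) none (some c) (some d) ∧
      YangBaxterAt β α γ x y M (some c) none (some d) (some c)) ∧
    (∀ M, insert d N = M ∨ insert c (insert d N) = M →
      YangBaxterAt β α γ x y M (some c) (some d) none (some c) ∧
      YangBaxterAt β α γ x y M (some d) (some c) none (some c) ∧
      YangBaxterAt β α γ x y M (some c) (some d) (some c) none ∧
      YangBaxterAt β α γ x y M (some d) (some c) (some c) none) ∧
    (∀ M, N = M ∨ insert c N = M ∨ insert d N = M ∨ insert c (insert d N) = M →
      YangBaxterAt β α γ x y M (some c) (some d) (some c) (some d) ∧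
      YangBaxterAt β α γ x y M (some c) (some d) (some d) (some c)) ∧
    YangBaxterAt β α γ x y (insert d N) (some c) (some d) (some c) (some c) ∧
    YangBaxterAt β α γ x y (insert d N) (some d) (some c) (some c) (some c) ∧
    YangBaxterAt β α γ x y (insert c N) (some c) (some c) (some c) (some d) ∧
    YangBaxterAt β α γ x y (insert c N) (some c) (some c) (some d) (some c) := by
  have hdc := hcd.symm
  refine ⟨⟨?_, ?_, ?_, ?_, ?_, ?_⟩, ?_, ?_, ?_, ?_, ?_, ?_, ?_⟩
  on_goal 7 => rintro M (rfl | rfl) <;> refine ⟨?_, ?_, ?_, ?_⟩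
  on_goal 15 => rintro M (rfl | rfl) <;> refine ⟨?_, ?_, ?_, ?_⟩
  on_goal 23 => rintro M (rfl | rfl | rfl | rfl) <;> refine ⟨?_, ?_⟩
  all_goals
    rcases lt_and_not_gt_or hcd with ⟨h, h'⟩ | ⟨h, h'⟩
  all_goals
    simp only [hc, hd, hcd, hdc, h, h',
      Finset.mem_insert, Finset.mem_erase, Finset.erase_insert_of_ne, Finset.erase_insert,
      Finset.card_insert_of_notMem, numAbove_insert, Nat.add_sub_cancel, homogPred, ne_eq,
      not_true_eq_false, not_false_eq_true, or_false, or_true, false_or, true_or, and_true,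
      and_false, if_true, if_false, lt_self_iff_false, add_zero, pow_succ, pow_zero, mul_zero,
      zero_mul, YangBaxterAt, vertexWeight, southLabel, rDiag, rSwap, oplusOne,
      kirillovFactor]
    generalize β ^ N.card = B
    generalize (-1 : A) ^ N.card = E
    generalize homogPred α β N.card = H
    generalize (-α) ^ numAbove N c = u0
    generalize (-β) ^ numAbove N c = v0
    generalize (-α) ^ numAbove N d = u1
    generalize (-β) ^ numAbove N d = v1
    ring1

set_option linter.unusedSimpArgs false in
set_option maxHeartbeats 4000000 in
/-- The cases of the Yang–Baxter equation with three colors on the horizontal edges. -/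
theorem yangBaxterAt_three (β α γ x y : A) {N : Finset (Fin n)} {c d g : Fin n} (hc : c ∉ N)
    (hd : d ∉ N) (hg : g ∉ N) (hcd : c ≠ d) (hcg : c ≠ g) (hdg : d ≠ g) :
    YangBaxterAt β α γ x y (insert c N) none (some c) (some d) (some g) ∧
    YangBaxterAt β α γ x y (insert c N) (some c) none (some d) (some g) ∧
    YangBaxterAt β α γ x y (insert c (insert d N)) (some c) (some d) none (some g) ∧
    YangBaxterAt β α γ x y (insert c (insert d N)) (some c) (some d) (some g) none ∧
    ∀ M, insert d N = M ∨ insert c (insert d N) = M →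
      YangBaxterAt β α γ x y M (some c) (some d) (some c) (some g) ∧
      YangBaxterAt β α γ x y M (some c) (some d) (some g) (some c) ∧
      YangBaxterAt β α γ x y M (some d) (some c) (some c) (some g) ∧
      YangBaxterAt β α γ x y M (some d) (some c) (some g) (some c) := by
  have hdc := hcd.symm
  have hgc := hcg.symm
  have hgd := hdg.symm
  refine ⟨?_, ?_, ?_, ?_, ?_⟩
  on_goal 5 => rintro M (rfl | rfl) <;> refine ⟨?_, ?_, ?_, ?_⟩
  all_goals
    rcases lt_and_not_gt_or hcd with ⟨h, h'⟩ | ⟨h, h'⟩ <;>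
    rcases lt_and_not_gt_or hcg with ⟨i, i'⟩ | ⟨i, i'⟩ <;>
    rcases lt_and_not_gt_or hdg with ⟨j, j'⟩ | ⟨j, j'⟩
  -- Discards the cyclic, hence impossible, orderings of the three colors.
  all_goals try (exfalso; omega)
  all_goals
    simp only [hc, hd, hg, hcd, hdc, hcg, hgc, hdg, hgd, h, h', i, i', j, j',
      Finset.mem_insert, Finset.mem_erase, Finset.erase_insert_of_ne, Finset.erase_insert,
      Finset.card_insert_of_notMem, numAbove_insert, Nat.add_sub_cancel, homogPred, ne_eq,
      not_true_eq_false, not_false_eq_true, or_false, or_true, false_or, true_or, and_true,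
      and_false, if_true, if_false, lt_self_iff_false, add_zero, pow_succ, pow_zero, mul_zero,
      zero_mul, YangBaxterAt, vertexWeight, southLabel, rDiag, rSwap, oplusOne,
      kirillovFactor]
    generalize β ^ N.card = B
    generalize (-1 : A) ^ N.card = E
    generalize homogPred α β N.card = H
    generalize (-α) ^ numAbove N c = u0
    generalize (-β) ^ numAbove N c = v0
    generalize (-α) ^ numAbove N d = u1
    generalize (-β) ^ numAbove N d = v1
    generalize (-α) ^ numAbove N g = u2
    generalize (-β) ^ numAbove N g = v2
    ring1

set_option linter.unusedSimpArgs false in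
set_option maxHeartbeats 4000000 in
/-- The cases of the Yang–Baxter equation with four colors on the horizontal edges. -/
theorem yangBaxterAt_four (β α γ x y : A) {N : Finset (Fin n)} {c d g k : Fin n} (hc : c ∉ N)
    (hd : d ∉ N) (hg : g ∉ N) (hk : k ∉ N) (hcd : c ≠ d) (hcg : c ≠ g) (hdg : d ≠ g)
    (hck : c ≠ k) (hdk : d ≠ k) (hgk : g ≠ k) :
    YangBaxterAt β α γ x y (insert c (insert d N)) (some c) (some d) (some g) (some k) := by
  have hdc := hcd.symm
  have hgc := hcg.symm
  have hgd := hdg.symm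
  have hkc := hck.symm
  have hkd := hdk.symm
  have hkg := hgk.symm
  rcases lt_and_not_gt_or hcd with ⟨h, h'⟩ | ⟨h, h'⟩ <;>
    rcases lt_and_not_gt_or hcg with ⟨i, i'⟩ | ⟨i, i'⟩ <;>
    rcases lt_and_not_gt_or hdg with ⟨j, j'⟩ | ⟨j, j'⟩
  all_goals try (exfalso; omega)
  all_goals
    rcases lt_and_not_gt_or hck with ⟨p, p'⟩ | ⟨p, p'⟩ <;>
    rcases lt_and_not_gt_or hdk with ⟨l, l'⟩ | ⟨l, l'⟩ <;>
    rcases lt_and_not_gt_or hgk with ⟨m, m'⟩ | ⟨m, m'⟩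
  all_goals try (exfalso; omega)
  all_goals
    simp only [hc, hd, hg, hk, hcd, hdc, hcg, hgc, hdg, hgd, hck, hkc, hdk, hkd, hgk, hkg, h, h',
      i, i', j, j', p, p', l, l', m, m',
      Finset.mem_insert, Finset.mem_erase, Finset.erase_insert_of_ne, Finset.erase_insert,
      Finset.card_insert_of_notMem, numAbove_insert, Nat.add_sub_cancel, homogPred, ne_eq,
      not_true_eq_false, not_false_eq_true, or_false, or_true, false_or, true_or, and_true,
      and_false, if_true, if_false, lt_self_iff_false, add_zero, pow_succ, pow_zero, mul_zero,
      zero_mul, YangBaxterAt, vertexWeight, southLabel, rDiag, rSwap, oplusOne,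
      kirillovFactor]
    -- No horizontal edge carries `+` here, so neither the cardinality of `N` nor `homogPred`
    -- occurs.
    generalize (-α) ^ numAbove N c = u0
    generalize (-β) ^ numAbove N c = v0
    generalize (-α) ^ numAbove N d = u1
    generalize (-β) ^ numAbove N d = v1
    generalize (-α) ^ numAbove N g = u2
    generalize (-β) ^ numAbove N g = v2
    generalize (-α) ^ numAbove N k = u3
    generalize (-β) ^ numAbove N k = v3
    ring1

end YangBaxter

/-! ### The Yang–Baxter equation: reduction to the listed configurations. -/

section YangBaxter

variable {A : Type*} [CommRing A] {n : ℕ}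

theorem exists_eq_insert {N : Finset (Fin n)} {c : Fin n} (h : c ∈ N) :
    ∃ N₀, c ∉ N₀ ∧ N = insert c N₀ :=
  ⟨N.erase c, Finset.notMem_erase c N, (Finset.insert_erase h).symm⟩

theorem exists_eq_or_eq_insert (N : Finset (Fin n)) (c : Fin n) :
    ∃ N₀, c ∉ N₀ ∧ (N₀ = N ∨ insert c N₀ = N) :=
  ⟨N.erase c, Finset.notMem_erase c N, by
    by_cases h : c ∈ N
    · exact Or.inr (Finset.insert_erase h)
    · exact Or.inl (Finset.erase_eq_of_notMem h)⟩

theorem exists_eq_insert_insert {N : Finset (Fin n)} {c d : Fin n} (hc : c ∈ N) (hd : d ∈ N)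
    (h : c ≠ d) : ∃ N₀, c ∉ N₀ ∧ d ∉ N₀ ∧ N = insert c (insert d N₀) := by
  refine ⟨(N.erase c).erase d, by simp, by simp, ?_⟩
  rw [Finset.insert_erase (Finset.mem_erase.2 ⟨h.symm, hd⟩), Finset.insert_erase hc]

theorem yangBaxterAt_some_some_some_some (β α γ x y : A) {N S : Finset (Fin n)}
    {a b e f : Fin n} (H : Conserved (some a) (some b) (some e) (some f) N S) :
    YangBaxterAt β α γ x y N (some a) (some b) (some e) (some f) := by
  have Ha := H a
  have Hb := H b
  have He := H e
  have Hf := H f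
  simp only [memCount, labelCount, Option.some.injEq] at Ha Hb He Hf
  -- The case analysis uses only these consequences of conservation. A color occurring only on the
  -- west must lie in `N`, one occurring only on the east must not, and one occurring equally often
  -- on both sides is unconstrained.
  have Ce : e ∈ N → e = a ∨ e = b := by grind
  have Cf : f ∈ N → f = a ∨ f = b := by grind
  have Ca : a ∈ N ∨ a = e ∨ a = f := by grind
  have Cb : b ∈ N ∨ b = e ∨ b = f := by grind
  have Cab : a = b → (a = e ∨ a = f) ∧ (a ∈ N ∨ (a = e ∧ a = f)) := by grind
  have Cef : e = f → (e = a ∨ e = b) ∧ (e ∈ N → e = a ∧ e = b) := by grind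
  clear Ha Hb He Hf H
  by_cases hab : a = b
  · subst hab
    by_cases hae : a = e
    · subst hae
      by_cases haf : a = f
      · subst haf
        obtain ⟨N₀, h₀, h⟩ := exists_eq_or_eq_insert N a
        exact (yangBaxterAt_one β α γ x y h₀).2.2.2 N h
      · have hf : f ∉ N := by grind
        obtain ⟨N₀, h₀, rfl⟩ := exists_eq_insert (show a ∈ N by grind)
        exact (yangBaxterAt_two β α γ x y h₀ (by grind : f ∉ N₀) haf).2.2.2.2.2.2.1
    · have haf : a = f := by grind
      subst haf
      have he : e ∉ N := by grind
      obtain ⟨N₀, h₀, rfl⟩ := exists_eq_insert (show a ∈ N by grind)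
      exact (yangBaxterAt_two β α γ x y h₀ (by grind : e ∉ N₀) hae).2.2.2.2.2.2.2
  by_cases hef : e = f
  · subst hef
    by_cases hae : a = e
    · subst hae
      have ha : a ∉ N := by grind
      obtain ⟨N₀, h₀, rfl⟩ := exists_eq_insert (show b ∈ N by grind)
      exact (yangBaxterAt_two β α γ x y (by grind : a ∉ N₀) h₀ hab).2.2.2.2.1
    · have hbe : b = e := by grind
      subst hbe
      have ha : b ∉ N := by grind
      obtain ⟨N₀, h₀, rfl⟩ := exists_eq_insert (show a ∈ N by grind)
      exact (yangBaxterAt_two β α γ x y (by grind : b ∉ N₀) h₀ (Ne.symm hab)).2.2.2.2.2.1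
  by_cases hae : a = e
  · subst hae
    by_cases hbf : b = f
    · subst hbf
      obtain ⟨N₀, h₀, h⟩ := exists_eq_or_eq_insert N a
      obtain ⟨N₁, h₁, h'⟩ := exists_eq_or_eq_insert N₀ b
      exact ((yangBaxterAt_two β α γ x y (by grind : a ∉ N₁) h₁ hab).2.2.2.1 N (by grind)).1
    · have hf : f ∉ N := by grind
      obtain ⟨N₀, h₀, h⟩ := exists_eq_or_eq_insert N a
      obtain ⟨N₁, h₁, rfl⟩ := exists_eq_insert (show b ∈ N₀ by grind)
      exact ((yangBaxterAt_three β α γ x y (by grind : a ∉ N₁) h₁ (by grind : f ∉ N₁) hab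
        hef hbf).2.2.2.2 N h).1
  by_cases haf : a = f
  · subst haf
    by_cases hbe : b = e
    · subst hbe
      obtain ⟨N₀, h₀, h⟩ := exists_eq_or_eq_insert N a
      obtain ⟨N₁, h₁, h'⟩ := exists_eq_or_eq_insert N₀ b
      exact ((yangBaxterAt_two β α γ x y (by grind : a ∉ N₁) h₁ hab).2.2.2.1 N (by grind)).2
    · have he : e ∉ N := by grind
      obtain ⟨N₀, h₀, h⟩ := exists_eq_or_eq_insert N a
      obtain ⟨N₁, h₁, rfl⟩ := exists_eq_insert (show b ∈ N₀ by grind)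
      exact ((yangBaxterAt_three β α γ x y (by grind : a ∉ N₁) h₁ (by grind : e ∉ N₁) hab
        hae hbe).2.2.2.2 N h).2.1
  have ha : a ∈ N := by grind
  by_cases hbe : b = e
  · subst hbe
    have hf : f ∉ N := by grind
    obtain ⟨N₀, h₀, h⟩ := exists_eq_or_eq_insert N b
    obtain ⟨N₁, h₁, rfl⟩ := exists_eq_insert (show a ∈ N₀ by grind)
    exact ((yangBaxterAt_three β α γ x y (by grind : b ∉ N₁) h₁ (by grind : f ∉ N₁)
      (Ne.symm hab) hef haf).2.2.2.2 N h).2.2.1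
  by_cases hbf : b = f
  · subst hbf
    have he : e ∉ N := by grind
    obtain ⟨N₀, h₀, h⟩ := exists_eq_or_eq_insert N b
    obtain ⟨N₁, h₁, rfl⟩ := exists_eq_insert (show a ∈ N₀ by grind)
    exact ((yangBaxterAt_three β α γ x y (by grind : b ∉ N₁) h₁ (by grind : e ∉ N₁)
      (Ne.symm hab) hbe hae).2.2.2.2 N h).2.2.2
  have hb : b ∈ N := by grind
  have he : e ∉ N := by grind
  have hf : f ∉ N := by grind
  obtain ⟨N₀, h₀, h₁, rfl⟩ := exists_eq_insert_insert ha hb hab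
  exact yangBaxterAt_four β α γ x y h₀ h₁ (by grind) (by grind) hab hae hbe haf hbf hef

/-- The case in which exactly one western label is `+`. -/
theorem yangBaxterAt_west_none (β α γ x y : A) {N S : Finset (Fin n)} {b e f : Fin n}
    (H : Conserved none (some b) (some e) (some f) N S) :
    YangBaxterAt β α γ x y N none (some b) (some e) (some f) ∧
      YangBaxterAt β α γ x y N (some b) none (some e) (some f) := by
  have Hb := H b
  have He := H e
  have Hf := H f
  simp only [memCount, labelCount, Option.some.injEq] at Hb He Hf
  have Ce : e ∈ N → e = b := by grind
  have Cf : f ∈ N → f = b := by grind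
  have Cb : b ∈ N ∨ b = e ∨ b = f := by grind
  have Cef : e = f → e = b ∧ e ∉ N := by grind
  clear Hb He Hf H
  by_cases hef : e = f
  · subst hef
    have hbe : e = b := by grind
    subst hbe
    have h := (yangBaxterAt_one β α γ x y (by grind : e ∉ N)).2.2.1
    exact ⟨h.1, h.2.1⟩
  by_cases hbe : b = e
  · subst hbe
    obtain ⟨N₀, h₀, h⟩ := exists_eq_or_eq_insert N b
    have h := (yangBaxterAt_two β α γ x y h₀ (by grind : f ∉ N₀) hef).2.1 N h
    exact ⟨h.1, h.2.2.1⟩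
  by_cases hbf : b = f
  · subst hbf
    obtain ⟨N₀, h₀, h⟩ := exists_eq_or_eq_insert N b
    have h := (yangBaxterAt_two β α γ x y h₀ (by grind : e ∉ N₀) hbe).2.1 N h
    exact ⟨h.2.1, h.2.2.2⟩
  have he : e ∉ N := by grind
  have hf : f ∉ N := by grind
  obtain ⟨N₀, h₀, rfl⟩ := exists_eq_insert (show b ∈ N by grind)
  have h := yangBaxterAt_three β α γ x y h₀ (by grind : e ∉ N₀) (by grind : f ∉ N₀) hbe hbf hef
  exact ⟨h.1, h.2.1⟩

/-- The case in which exactly one eastern label is `+`. -/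
theorem yangBaxterAt_east_none (β α γ x y : A) {N S : Finset (Fin n)} {a b f : Fin n}
    (H : Conserved (some a) (some b) none (some f) N S) :
    YangBaxterAt β α γ x y N (some a) (some b) none (some f) ∧
      YangBaxterAt β α γ x y N (some a) (some b) (some f) none := by
  have Ha := H a
  have Hb := H b
  have Hf := H f
  simp only [memCount, labelCount, Option.some.injEq] at Ha Hb Hf
  have Cf : f ∈ N → f = a ∨ f = b := by grind
  have Ca : a ∈ N ∨ a = f := by grind
  have Cb : b ∈ N ∨ b = f := by grind
  have Cab : a = b → a = f ∧ a ∈ N := by grind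
  clear Ha Hb Hf H
  by_cases hab : a = b
  · subst hab
    have haf : a = f := by grind
    subst haf
    obtain ⟨N₀, h₀, rfl⟩ := exists_eq_insert (show a ∈ N by grind)
    have h := (yangBaxterAt_one β α γ x y h₀).2.2.1
    exact ⟨h.2.2.1, h.2.2.2⟩
  by_cases haf : a = f
  · subst haf
    obtain ⟨N₀, h₀, h⟩ := exists_eq_or_eq_insert N a
    obtain ⟨N₁, h₁, rfl⟩ := exists_eq_insert (show b ∈ N₀ by grind)
    have h := (yangBaxterAt_two β α γ x y (by grind : a ∉ N₁) h₁ hab).2.2.1 N h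
    exact ⟨h.1, h.2.2.1⟩
  by_cases hbf : b = f
  · subst hbf
    obtain ⟨N₀, h₀, h⟩ := exists_eq_or_eq_insert N b
    obtain ⟨N₁, h₁, rfl⟩ := exists_eq_insert (show a ∈ N₀ by grind)
    have h := (yangBaxterAt_two β α γ x y (by grind : b ∉ N₁) h₁ (Ne.symm hab)).2.2.1 N h
    exact ⟨h.2.1, h.2.2.2⟩
  have hf : f ∉ N := by grind
  obtain ⟨N₀, h₀, h₁, rfl⟩ :=
    exists_eq_insert_insert (show a ∈ N by grind) (show b ∈ N by grind) hab
  have h := yangBaxterAt_three β α γ x y h₀ h₁ (by grind : f ∉ N₀) hab haf hbf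
  exact ⟨h.2.2.1, h.2.2.2.1⟩

/-- The cases in which exactly one western and one eastern label are `+`. -/
theorem yangBaxterAt_west_none_east_none (β α γ x y : A) {N S : Finset (Fin n)} {b f : Fin n}
    (H : Conserved none (some b) none (some f) N S) :
    YangBaxterAt β α γ x y N none (some b) none (some f) ∧
      YangBaxterAt β α γ x y N none (some b) (some f) none ∧
      YangBaxterAt β α γ x y N (some b) none none (some f) ∧
      YangBaxterAt β α γ x y N (some b) none (some f) none := by
  have Hb := H b
  have Hf := H f
  simp only [memCount, labelCount, Option.some.injEq] at Hb Hf
  have Cf : f ∈ N → f = b := by grind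
  have Cb : b ∈ N ∨ b = f := by grind
  clear Hb Hf H
  by_cases hbf : b = f
  · subst hbf
    obtain ⟨N₀, h₀, h⟩ := exists_eq_or_eq_insert N b
    have h := (yangBaxterAt_one β α γ x y h₀).2.1 N h
    exact ⟨h.2.2.2, h.2.2.1, h.2.1, h.1⟩
  have hf : f ∉ N := by grind
  obtain ⟨N₀, h₀, rfl⟩ := exists_eq_insert (show b ∈ N by grind)
  have h := (yangBaxterAt_two β α γ x y h₀ (by grind : f ∉ N₀) hbf).1
  exact h.2.2

theorem yangBaxterAt_of_conserved (β α γ x y : A) {N S : Finset (Fin n)}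
    {a b e f : Option (Fin n)} (H : Conserved a b e f N S) :
    YangBaxterAt β α γ x y N a b e f := by
  have C : ∀ c : Fin n, (if c ∈ N then 1 else 0) + (if e = some c then 1 else 0)
      + (if f = some c then 1 else 0) = (if c ∈ S then 1 else 0)
      + (if a = some c then 1 else 0) + (if b = some c then 1 else 0) := H
  rcases a with _ | a <;> rcases b with _ | b <;> rcases e with _ | e <;> rcases f with _ | f
  · exact yangBaxterAt_zero β α γ x y N
  · have hf : f ∉ N := by grind
    exact (yangBaxterAt_one β α γ x y hf).1.2.2.2
  · have he : e ∉ N := by grind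
    exact (yangBaxterAt_one β α γ x y he).1.2.2.1
  · have he : e ∉ N := by grind
    have hf : f ∉ N := by grind
    have hef : e ≠ f := by grind
    exact (yangBaxterAt_two β α γ x y he hf hef).1.1
  · obtain ⟨N₀, h₀, rfl⟩ := exists_eq_insert (show b ∈ N by grind)
    exact (yangBaxterAt_one β α γ x y h₀).1.2.1
  · exact (yangBaxterAt_west_none_east_none β α γ x y H).1
  · exact (yangBaxterAt_west_none_east_none β α γ x y H.swap_east).2.1
  · exact (yangBaxterAt_west_none β α γ x y H).1
  · obtain ⟨N₀, h₀, rfl⟩ := exists_eq_insert (show a ∈ N by grind)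
    exact (yangBaxterAt_one β α γ x y h₀).1.1
  · exact (yangBaxterAt_west_none_east_none β α γ x y H.swap_west).2.2.1
  · exact (yangBaxterAt_west_none_east_none β α γ x y H.swap_west.swap_east).2.2.2
  · exact (yangBaxterAt_west_none β α γ x y H.swap_west).2
  · have hab : a ≠ b := by grind
    obtain ⟨N₀, h₀, h₁, rfl⟩ :=
      exists_eq_insert_insert (show a ∈ N by grind) (show b ∈ N by grind) hab
    exact (yangBaxterAt_two β α γ x y h₀ h₁ hab).1.2.1
  · exact (yangBaxterAt_east_none β α γ x y H).1
  · exact (yangBaxterAt_east_none β α γ x y H.swap_east).2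
  · exact yangBaxterAt_some_some_some_some β α γ x y H

/-- The Yang–Baxter equation for one column. -/
theorem yangBaxter (β α γ x y : A) (a b e f : Option (Fin n)) (N S : Finset (Fin n)) :
    rDiag β α γ x y a b * pairWeight β α γ x y a b e f N S
        + rSwap β α x y a b * pairWeight β α γ x y b a e f N S
      = pairWeight β α γ y x a b e f N S * rDiag β α γ x y e f
        + pairWeight β α γ y x a b f e N S * rSwap β α x y f e := by
  by_cases H : Conserved a b e f N S
  -- Conservation is symmetric in the two western and in the two eastern labels, so it holds or
  -- fails for all four terms at once; if it fails, every term vanishes.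
  · rw [pairWeight_eq_of_conserved β α γ x y H, pairWeight_eq_of_conserved β α γ x y H.swap_west,
      pairWeight_eq_of_conserved β α γ y x H, pairWeight_eq_of_conserved β α γ y x H.swap_east]
    exact yangBaxterAt_of_conserved β α γ x y H
  · rw [pairWeight_eq_zero β α γ x y H, pairWeight_eq_zero β α γ x y fun h => H h.swap_west,
      pairWeight_eq_zero β α γ y x H, pairWeight_eq_zero β α γ y x fun h => H h.swap_east]
    ring

end YangBaxter

/-! ### From one column to rows and grids: the train argument. -/

section Rows

variable {A : Type*} [CommRing A] {n : ℕ}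

/-- The partition function of a single row with `K` columns, right edge `+` and the given northern,
southern and western labels. -/
def rowWeight (β α γ x : A) : (K : ℕ) → (N S : Fin K → Finset (Fin n)) → Option (Fin n) → A
  | 0, _, _, a => if a = none then 1 else 0
  | K + 1, N, S, a => ∑ e, boltzmannWeight β α γ x a (N (Fin.last K)) e (S (Fin.last K)) *
      rowWeight β α γ x K (fun j => N j.castSucc) (fun j => S j.castSucc) e

/-- The partition function of two adjacent rows with spectral parameters `x` (above) and `y`. -/
def twoRowWeight (β α γ x y : A) :
    (K : ℕ) → (N S : Fin K → Finset (Fin n)) → Option (Fin n) → Option (Fin n) → A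
  | 0, _, _, a, b => if a = none ∧ b = none then 1 else 0
  | K + 1, N, S, a, b => ∑ e, ∑ f, pairWeight β α γ x y a b e f (N (Fin.last K)) (S (Fin.last K)) *
      twoRowWeight β α γ x y K (fun j => N j.castSucc) (fun j => S j.castSucc) e f

theorem sum_fin_snoc {K : ℕ} {V : Type*} [Fintype V] (F : (Fin (K + 1) → V) → A) :
    ∑ M, F M = ∑ v, ∑ M : Fin K → V, F (Fin.snoc M v) := by
  rw [← (Fin.snocEquiv fun _ : Fin (K + 1) => V).sum_comp, Fintype.sum_prod_type]
  rfl

theorem sum_fin_cons {K : ℕ} {V : Type*} [Fintype V] (F : (Fin (K + 1) → V) → A) :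
    ∑ M, F M = ∑ v, ∑ M : Fin K → V, F (Fin.cons v M) := by
  rw [← (Fin.consEquiv fun _ : Fin (K + 1) => V).sum_comp, Fintype.sum_prod_type]
  rfl

/-- The vertical labels between the two rows are summed independently in each column, so the double
row is built from `pairWeight` one column at a time. -/
theorem sum_rowWeight_mul_rowWeight (β α γ x y : A) (K : ℕ) (N S : Fin K → Finset (Fin n))
    (a b : Option (Fin n)) :
    ∑ M, rowWeight β α γ x K N M a * rowWeight β α γ y K M S b =
      twoRowWeight β α γ x y K N S a b := by
  induction K generalizing a b with
  | zero =>
    rw [Fintype.sum_unique]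
    simp only [rowWeight, twoRowWeight]
    by_cases ha : a = none <;> by_cases hb : b = none <;> simp [ha, hb]
  | succ K ih =>
    rw [sum_fin_snoc]
    simp only [rowWeight, twoRowWeight, Fin.snoc_last, Fin.snoc_castSucc]
    simp only [← ih, pairWeight, Finset.sum_mul_sum]
    rw [Finset.sum_congr rfl fun M₀ _ => Finset.sum_comm]
    rw [Finset.sum_comm]
    refine Finset.sum_congr rfl fun e _ => ?_
    rw [Finset.sum_congr rfl fun M₀ _ => Finset.sum_comm]
    rw [Finset.sum_comm]
    refine Finset.sum_congr rfl fun f _ => Finset.sum_congr rfl fun M₀ _ =>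
      Finset.sum_congr rfl fun M _ => ?_
    ring

/-- The R-matrix attached on the east of the remaining columns moves past the leftmost one by
`yangBaxter`. With no columns left, both labels are `+`, where the off-diagonal entry is `0` and the
diagonal one is `kirillovFactor`. -/
theorem twoRowWeight_exchange (β α γ x y : A) (K : ℕ) (N S : Fin K → Finset (Fin n))
    (a b : Option (Fin n)) :
    kirillovFactor β α γ x y * twoRowWeight β α γ y x K N S a b =
      rDiag β α γ x y a b * twoRowWeight β α γ x y K N S a b +
        rSwap β α x y a b * twoRowWeight β α γ x y K N S b a := by
  induction K generalizing a b with
  | zero => rcases a with _ | a <;> rcases b with _ | b <;> simp [twoRowWeight, rDiag, rSwap]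
  | succ K ih =>
    simp only [twoRowWeight]
    set N' : Fin K → Finset (Fin n) := fun j => N j.castSucc
    set S' : Fin K → Finset (Fin n) := fun j => S j.castSucc
    set N₀ := N (Fin.last K)
    set S₀ := S (Fin.last K)
    calc kirillovFactor β α γ x y * ∑ e, ∑ f, pairWeight β α γ y x a b e f N₀ S₀ *
            twoRowWeight β α γ y x K N' S' e f
        = ∑ e, ∑ f, (pairWeight β α γ y x a b e f N₀ S₀ * rDiag β α γ x y e f *
              twoRowWeight β α γ x y K N' S' e f +
            pairWeight β α γ y x a b e f N₀ S₀ * rSwap β α x y e f *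
              twoRowWeight β α γ x y K N' S' f e) := by
          rw [Finset.mul_sum]
          refine Finset.sum_congr rfl fun e _ => ?_
          rw [Finset.mul_sum]
          refine Finset.sum_congr rfl fun f _ => ?_
          rw [mul_left_comm, ih]
          ring
      _ = ∑ e, ∑ f, (rDiag β α γ x y a b * pairWeight β α γ x y a b e f N₀ S₀ +
            rSwap β α x y a b * pairWeight β α γ x y b a e f N₀ S₀) *
              twoRowWeight β α γ x y K N' S' e f := by
          simp only [Finset.sum_add_distrib]
          -- Exchanging the names `e` and `f` in the off-diagonal part gives both parts the common
          -- factor for the remaining columns, so `yangBaxter` applies termwise.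
          rw [Finset.sum_comm (f := fun e f => pairWeight β α γ y x a b e f N₀ S₀ *
            rSwap β α x y e f * twoRowWeight β α γ x y K N' S' f e)]
          simp only [← Finset.sum_add_distrib]
          refine Finset.sum_congr rfl fun e _ => Finset.sum_congr rfl fun f _ => ?_
          rw [yangBaxter]
          ring
      _ = rDiag β α γ x y a b * (∑ e, ∑ f, pairWeight β α γ x y a b e f N₀ S₀ *
              twoRowWeight β α γ x y K N' S' e f) +
          rSwap β α x y a b * ∑ e, ∑ f, pairWeight β α γ x y b a e f N₀ S₀ *
              twoRowWeight β α γ x y K N' S' e f := by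
          simp only [Finset.mul_sum, ← Finset.sum_add_distrib]
          refine Finset.sum_congr rfl fun e _ => Finset.sum_congr rfl fun f _ => ?_
          ring

/-- The partition function of a grid with `r` rows and `K` columns whose right boundary edges carry
`+` and whose bottom boundary edges carry `∅`. -/
def gridWeight (β α γ : A) (K : ℕ) :
    (r : ℕ) → (Fin r → A) → (Fin r → Option (Fin n)) → (Fin K → Finset (Fin n)) → A
  | 0, _, _, N => if N = fun _ => ∅ then 1 else 0
  | r + 1, x, a, N => ∑ M, rowWeight β α γ (x 0) K N M (a 0) *
      gridWeight β α γ K r (fun i => x i.succ) (fun i => a i.succ) M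

theorem simpleTransposition_succ_zero {m : ℕ} (i : Fin m) :
    simpleTransposition i.succ 0 = 0 :=
  Equiv.swap_apply_of_ne_of_ne (by simp [Fin.ext_iff]) (by simp [Fin.ext_iff])

theorem simpleTransposition_succ_succ {m : ℕ} (i : Fin m) (k : Fin (m + 1)) :
    simpleTransposition i.succ k.succ = (simpleTransposition i k).succ := by
  unfold simpleTransposition
  rw [← Fin.succ_castSucc]
  exact (Fin.succ_injective _).swap_apply _ _ _

/-- Rows above the pair are common to all three terms and are peeled off by induction; for the top
pair this is `twoRowWeight_exchange`, with the rows below as a common factor. -/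
theorem gridWeight_exchange (β α γ : A) (K : ℕ) {m : ℕ} (i : Fin m) (x : Fin (m + 1) → A)
    (a : Fin (m + 1) → Option (Fin n)) (N : Fin K → Finset (Fin n)) :
    kirillovFactor β α γ (x i.castSucc) (x i.succ) *
        gridWeight β α γ K (m + 1) (fun k => x (simpleTransposition i k)) a N =
      rDiag β α γ (x i.castSucc) (x i.succ) (a i.castSucc) (a i.succ) *
          gridWeight β α γ K (m + 1) x a N +
        rSwap β α (x i.castSucc) (x i.succ) (a i.castSucc) (a i.succ) *
          gridWeight β α γ K (m + 1) x (fun k => a (simpleTransposition i k)) N := by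
  induction m generalizing N with
  | zero => exact i.elim0
  | succ m ih =>
    induction i using Fin.cases with
    | zero =>
      have h0 : simpleTransposition (0 : Fin (m + 1)) 0 = 1 := Equiv.swap_apply_left _ _
      have h1 : simpleTransposition (0 : Fin (m + 1)) 1 = 0 :=
        Equiv.swap_apply_right _ _
      have h2 : ∀ k : Fin m, simpleTransposition (0 : Fin (m + 1)) k.succ.succ = k.succ.succ :=
        fun k => Equiv.swap_apply_of_ne_of_ne (by simp [Fin.ext_iff]) (by simp [Fin.ext_iff])
      have key : ∀ (u v : A) (c d : Option (Fin n)) (G : (Fin K → Finset (Fin n)) → A),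
          ∑ M, rowWeight β α γ u K N M c * ∑ S, rowWeight β α γ v K M S d * G S =
            ∑ S, twoRowWeight β α γ u v K N S c d * G S := by
        intro u v c d G
        simp only [← sum_rowWeight_mul_rowWeight, Finset.mul_sum, Finset.sum_mul]
        rw [Finset.sum_comm]
        refine Finset.sum_congr rfl fun S _ => Finset.sum_congr rfl fun M _ => ?_
        ring
      simp only [gridWeight, h0, h1, h2, key, Fin.castSucc_zero, Fin.succ_zero_eq_one]
      simp only [Finset.mul_sum, ← Finset.sum_add_distrib]
      refine Finset.sum_congr rfl fun S _ => ?_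
      rw [← mul_assoc, twoRowWeight_exchange]
      ring
    | succ i =>
      have ih' := fun M => ih i (fun k => x k.succ) (fun k => a k.succ) M
      rw [gridWeight.eq_2, gridWeight.eq_2, gridWeight.eq_2]
      simp only [simpleTransposition_succ_zero, simpleTransposition_succ_succ,
        ← Fin.succ_castSucc]
      simp only [Finset.mul_sum, ← Finset.sum_add_distrib]
      refine Finset.sum_congr rfl fun M _ => ?_
      rw [mul_left_comm, ih']
      ring

/-- Sorts the labelings of a row by the label of their leftmost edge, which becomes the summation
variable `e` in the recursion of `rowWeight`. -/
theorem sum_ite_fin_last {K : ℕ} {V : Type*} [Fintype V] [DecidableEq V]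
    (F : (Fin (K + 1) → V) → V → A) :
    ∑ h, F h (h (Fin.last K)) = ∑ e, ∑ h, if h (Fin.last K) = e then F h e else 0 := by
  rw [Finset.sum_comm]
  exact Finset.sum_congr rfl fun h _ => by simp

theorem rowWeight_eq_sum (β α γ x : A) (K : ℕ) (N S : Fin K → Finset (Fin n))
    (a : Option (Fin n)) :
    rowWeight β α γ x K N S a = ∑ h : Fin (K + 1) → Option (Fin n),
      if h (Fin.last K) = a ∧ h 0 = none then
        ∏ j : Fin K, boltzmannWeight β α γ x (h j.succ) (N j) (h j.castSucc) (S j)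
      else 0 := by
  induction K generalizing a with
  | zero =>
    rw [← (Equiv.funUnique (Fin 1) (Option (Fin n))).symm.sum_comp]
    simp only [rowWeight, Finset.univ_eq_empty, Finset.prod_empty, Equiv.funUnique_symm_apply,
      uniqueElim_const, ite_and, Finset.sum_ite_eq', Finset.mem_univ, if_true]
  | succ K ih =>
    rw [sum_fin_snoc]
    have h0 : ∀ (h : Fin (K + 1) → Option (Fin n)) (v : Option (Fin n)),
        (Fin.snoc h v : Fin (K + 2) → Option (Fin n)) 0 = h 0 := fun h v =>
      Fin.snoc_castSucc (α := fun _ => Option (Fin n)) v h 0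
    simp only [Fin.snoc_last, h0, Fin.prod_univ_castSucc, Fin.succ_last, Fin.snoc_castSucc,
      Fin.succ_castSucc, ite_and]
    rw [Finset.sum_comm]
    simp only [Finset.sum_ite_eq', Finset.mem_univ, if_true]
    rw [sum_ite_fin_last fun (h : Fin (K + 1) → Option (Fin n)) e => if h 0 = none then
        (∏ j : Fin K, boltzmannWeight β α γ x (h j.succ) (N j.castSucc) (h j.castSucc)
          (S j.castSucc)) * boltzmannWeight β α γ x a (N (Fin.last K)) e (S (Fin.last K)) else 0]
    simp only [rowWeight, ih, Finset.mul_sum]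
    refine Finset.sum_congr rfl fun e _ => Finset.sum_congr rfl fun h _ => ?_
    rw [ite_and]
    split_ifs <;> ring

theorem gridWeight_eq_sum (β α γ : A) (K r : ℕ) (x : Fin r → A) (a : Fin r → Option (Fin n))
    (N : Fin K → Finset (Fin n)) :
    gridWeight β α γ K r x a N = ∑ v : Fin (r + 1) → Fin K → Finset (Fin n),
      if v 0 = N ∧ v (Fin.last r) = fun _ => ∅ then
        ∏ i : Fin r, rowWeight β α γ (x i) K (v i.castSucc) (v i.succ) (a i)
      else 0 := by
  induction r generalizing N with
  | zero =>
    rw [← (Equiv.funUnique (Fin 1) (Fin K → Finset (Fin n))).symm.sum_comp]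
    simp only [gridWeight, Finset.univ_eq_empty, Finset.prod_empty, Equiv.funUnique_symm_apply,
      uniqueElim_const, ite_and, Finset.sum_ite_eq', Finset.mem_univ, if_true]
  | succ r ih =>
    rw [sum_fin_cons]
    simp only [Fin.cons_zero, ← Fin.succ_last, Fin.prod_univ_succ, Fin.castSucc_zero,
      Fin.cons_succ, ← Fin.succ_castSucc, ite_and]
    rw [Finset.sum_comm]
    simp only [Finset.sum_ite_eq', Finset.mem_univ, if_true, gridWeight, ih]
    simp only [Finset.mul_sum]
    rw [Finset.sum_comm]
    refine Finset.sum_congr rfl fun v _ => ?_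
    simp only [ite_and, mul_ite, mul_zero, Finset.sum_ite_eq, Finset.mem_univ, if_true]

theorem partitionFunction_eq_gridWeight {r N : ℕ} (β α γ : A) (x : Fin r → A)
    (left : Fin r → Option (Fin r)) (top : Fin (N + 1) → Finset (Fin r)) :
    partitionFunction β α γ x ⟨left, top, fun _ => none, fun _ => ∅⟩ =
      gridWeight β α γ (N + 1) r x left top := by
  classical
  rw [gridWeight_eq_sum, partitionFunction, Finset.sum_filter, Fintype.sum_prod_type,
    Finset.sum_comm]
  refine Finset.sum_congr rfl fun v _ => ?_
  simp only [rowWeight_eq_sum]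
  -- With all vertical labels fixed the rows are independent, so the product of row sums is the sum
  -- over all horizontal labelings.
  rw [Finset.prod_univ_sum]
  by_cases hv : v 0 = top ∧ v (Fin.last r) = fun _ => ∅
  · rw [if_pos hv]
    simp only [Fintype.piFinset_univ]
    refine Finset.sum_congr rfl fun h _ => ?_
    by_cases hh : ∀ i, h i (Fin.last (N + 1)) = left i ∧ h i 0 = none
    · rw [if_pos]
      · exact Finset.prod_congr rfl fun i _ => (if_pos (hh i)).symm
      · exact ⟨fun i => (hh i).1, congrFun hv.1, fun i => (hh i).2, congrFun hv.2⟩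
    · rw [if_neg fun hB => hh fun i => ⟨hB.1 i, hB.2.2.1 i⟩]
      obtain ⟨i, hi⟩ := not_forall.1 hh
      exact (Finset.prod_eq_zero (Finset.mem_univ i) (if_neg hi)).symm
  · rw [if_neg hv]
    refine Finset.sum_eq_zero fun h _ => if_neg fun hB => hv ⟨funext hB.2.1, funext hB.2.2.2⟩

theorem map_homogPred {B : Type*} [CommRing B] (φ : A →+* B) (α β : A) (k : ℕ) :
    φ (homogPred α β k) = homogPred (φ α) (φ β) k := by
  induction k with
  | zero => simp [homogPred]
  | succ k ih => simp [homogPred, ih]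

theorem map_boltzmannWeight {B : Type*} [CommRing B] (φ : A →+* B) (β α γ x : A)
    (a : Option (Fin n)) (N : Finset (Fin n)) (e : Option (Fin n)) (S : Finset (Fin n)) :
    φ (boltzmannWeight β α γ x a N e S) =
      boltzmannWeight (φ β) (φ α) (φ γ) (φ x) a N e S := by
  rw [boltzmannWeight_eq_ite, boltzmannWeight_eq_ite, apply_ite φ, map_zero]
  congr 1
  rcases a with _ | a <;> rcases e with _ | e <;>
    simp only [vertexWeight, oplusOne, apply_ite φ, map_mul, map_add, map_sub, map_pow, map_neg,
      map_one, map_zero, map_homogPred]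

theorem map_rowWeight {B : Type*} [CommRing B] (φ : A →+* B) (β α γ x : A) (K : ℕ)
    (N S : Fin K → Finset (Fin n)) (a : Option (Fin n)) :
    φ (rowWeight β α γ x K N S a) = rowWeight (φ β) (φ α) (φ γ) (φ x) K N S a := by
  induction K generalizing a with
  | zero => simp [rowWeight, apply_ite φ]
  | succ K ih => simp only [rowWeight, map_sum, map_mul, map_boltzmannWeight, ih]

/-- Applied to the renaming of variables by `sᵢ`, which fixes constants, this identifies `swapVars`
of a partition function with the partition function at exchanged spectral parameters. -/
theorem map_gridWeight {B : Type*} [CommRing B] (φ : A →+* B) (β α γ : A) (K r : ℕ)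
    (x : Fin r → A) (a : Fin r → Option (Fin n)) (N : Fin K → Finset (Fin n)) :
    φ (gridWeight β α γ K r x a N) =
      gridWeight (φ β) (φ α) (φ γ) K r (fun i => φ (x i)) a N := by
  induction r generalizing N with
  | zero => simp [gridWeight, apply_ite φ]
  | succ r ih => simp only [gridWeight, map_sum, map_mul, map_rowWeight, ih]

end Rows

/-! ### The identity permutation: a single state. -/

section BaseCase

variable {A : Type*} [CommRing A] {n : ℕ}

/-- With `+` on the right and `∅` on top no color enters the row; the only state has all horizontal
labels `+`, and each of its vertices has weight `β⁰ - 0 = 1`. -/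
theorem rowWeight_empty (β α γ x : A) (K : ℕ) (M : Fin K → Finset (Fin n))
    (a : Option (Fin n)) :
    rowWeight β α γ x K (fun _ => ∅) M a = if a = none ∧ M = fun _ => ∅ then 1 else 0 := by
  induction K generalizing a with
  | zero =>
    have : M = fun _ => ∅ := funext fun j => j.elim0
    simp [rowWeight, this]
  | succ K ih =>
    have hM : (M = fun _ => ∅) ↔
        M (Fin.last K) = ∅ ∧ (fun j : Fin K => M j.castSucc) = fun _ => ∅ := by
      constructor
      · rintro rfl; exact ⟨rfl, rfl⟩
      · rintro ⟨h1, h2⟩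
        funext j
        induction j using Fin.lastCases with
        | last => exact h1
        | cast j => exact congrFun h2 j
    simp only [rowWeight, ih]
    rw [Fintype.sum_eq_single none fun e he => by simp [he], boltzmannWeight_eq_ite]
    rcases a with _ | a
    · simp only [southLabel, vertexWeight, hM, ite_and]
      split_ifs <;> simp_all [homogPred]
    · simp [vertexWeight]

/-- A row whose exiting color `c` sits in column `p`, with no color to the right of column `p` and
only smaller colors to its left, has a single state. -/
theorem rowWeight_of_single (β α γ x : A) (c : Fin n) (p : ℕ) (K : ℕ) (hp : p < K)
    (N M : Fin K → Finset (Fin n)) (h_lt : ∀ j : Fin K, (j : ℕ) < p → N j = ∅)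
    (h_eq : ∀ j : Fin K, (j : ℕ) = p → N j = {c})
    (h_gt : ∀ j : Fin K, p < (j : ℕ) → ∀ d ∈ N j, d < c) :
    rowWeight β α γ x K N M (some c) =
      if M = fun j : Fin K => if (j : ℕ) = p then ∅ else N j then x ^ (K - 1 - p) else 0 := by
  induction K with
  | zero => omega
  | succ K ih =>
    have hM : (M = fun j : Fin (K + 1) => if (j : ℕ) = p then ∅ else N j) ↔
        M (Fin.last K) = (if K = p then ∅ else N (Fin.last K)) ∧
        (fun j : Fin K => M j.castSucc) =
          fun j : Fin K => if (j : ℕ) = p then ∅ else N j.castSucc := by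
      constructor
      · rintro rfl; exact ⟨by simp, by simp⟩
      · rintro ⟨h1, h2⟩
        funext j
        induction j using Fin.lastCases with
        | last => simpa using h1
        | cast j => simpa using congrFun h2 j
    rw [rowWeight]
    -- If `p` is the leftmost column, `c` turns from north to west there with weight `1`, and
    -- everything to its right is empty. Otherwise `c` crosses the leftmost column horizontally with
    -- weight `x`: no color there exceeds `c`, so the factor in `αβ` is trivial.
    by_cases hpK : p = K
    · subst hpK
      have hN : N (Fin.last p) = {c} := h_eq _ (by simp)
      have hN' : (fun j : Fin p => N j.castSucc) = fun _ => ∅ :=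
        funext fun j => h_lt _ (by simp)
      have hN'' : (fun j : Fin p => if (j : ℕ) = p then ∅ else N j.castSucc) = fun _ => ∅ := by
        funext j
        rw [if_neg (by omega)]
        exact congrFun hN' j
      simp only [hN', rowWeight_empty, hM, hN'']
      rw [Fintype.sum_eq_single none fun e he => by simp [he], boltzmannWeight_eq_ite]
      simp only [southLabel, vertexWeight, hN, ite_and]
      split_ifs <;> simp_all [homogPred, numAbove, Finset.filter_singleton]
    · have hc : c ∉ N (Fin.last K) := fun h => (h_gt (Fin.last K) (by simp; omega) c h).false
      have h0 : numAbove (N (Fin.last K)) c = 0 := by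
        rw [numAbove, Finset.card_eq_zero, Finset.filter_eq_empty_iff]
        exact fun d hd => (h_gt (Fin.last K) (by simp; omega) d hd).not_gt
      rw [Fintype.sum_eq_single (some c), boltzmannWeight_eq_ite,
        ih (by omega) (fun j => N j.castSucc) (fun j => M j.castSucc)
          (fun j hj => h_lt _ (by simpa using hj)) (fun j hj => h_eq _ (by simpa using hj))
          (fun j hj => h_gt _ (by simpa using hj))]
      · simp only [hM, southLabel, vertexWeight, if_true, if_neg hc, if_neg (Ne.symm hpK), h0,
          pow_zero, mul_one, ite_and, ite_mul, zero_mul, mul_ite, mul_zero]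
        have hpow : x * x ^ (K - 1 - p) = x ^ (K + 1 - 1 - p) := by
          rw [← pow_succ']
          congr 1
          omega
        rw [hpow]
        split_ifs <;> rfl
      · intro e he
        rw [boltzmannWeight_eq_ite]
        rcases e with _ | e
        · simp [vertexWeight, hc]
        · simp [vertexWeight, hc, show c ≠ e from fun h => he (h ▸ rfl)]

/-- The configuration in which row index `i` contributes the color `a i` in column `μ i`. -/
def placement {r : ℕ} (K : ℕ) (μ : Fin r → ℕ) (a : Fin r → Fin n) (j : Fin K) : Finset (Fin n) :=
  (Finset.univ.filter fun i => μ i = (j : ℕ)).image a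

theorem mem_placement {r : ℕ} {K : ℕ} {μ : Fin r → ℕ} {a : Fin r → Fin n} {j : Fin K}
    {d : Fin n} : d ∈ placement K μ a j ↔ ∃ i, μ i = (j : ℕ) ∧ a i = d := by
  simp [placement]

/-- The top row must emit its largest color, which sits alone in the rightmost occupied column. Thus
`rowWeight_of_single` applies, and what remains is again such a placement. -/
theorem gridWeight_placement (β α γ : A) (K r : ℕ) (x : Fin r → A) (μ : Fin r → ℕ)
    (a : Fin r → Fin n) (hμ : StrictMono μ) (ha : StrictAnti a) (hK : ∀ i, μ i < K) :
    gridWeight β α γ K r x (fun i => some (a i)) (placement K μ a) =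
      ∏ i, x i ^ (K - 1 - μ i) := by
  induction r with
  | zero =>
    rw [gridWeight, if_pos]
    · simp
    · funext j
      simp [placement]
  | succ r ih =>
    have hrow := fun M => rowWeight_of_single β α γ (x 0) (a 0) (μ 0) K (hK 0)
      (placement K μ a) M
      (fun j hj => by
        ext d
        simp only [mem_placement, Finset.notMem_empty, iff_false, not_exists, not_and]
        intro i hi
        have := hμ.monotone (Fin.zero_le i)
        omega)
      (fun j hj => by
        ext d
        simp only [mem_placement, Finset.mem_singleton]
        constructor
        · rintro ⟨i, hi, rfl⟩
          rw [hμ.injective (hi.trans hj)]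
        · rintro rfl
          exact ⟨0, hj.symm, rfl⟩)
      (fun j hj d hd => by
        obtain ⟨i, hi, rfl⟩ := mem_placement.1 hd
        refine ha (Fin.pos_of_ne_zero ?_)
        rintro rfl
        omega)
    have hrest : (fun j : Fin K => if (j : ℕ) = μ 0 then ∅ else placement K μ a j) =
        placement K (fun i => μ i.succ) (fun i => a i.succ) := by
      funext j
      ext d
      rw [mem_placement]
      by_cases hj : (j : ℕ) = μ 0
      · simp only [hj, if_true, Finset.notMem_empty, false_iff, not_exists, not_and]
        intro i hi
        exact absurd (hμ.injective hi) (Fin.succ_ne_zero i)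
      · rw [if_neg hj, mem_placement]
        constructor
        · rintro ⟨i, hi, hd⟩
          induction i using Fin.cases with
          | zero => exact absurd hi.symm hj
          | succ i => exact ⟨i, hi, hd⟩
        · rintro ⟨i, hi, hd⟩
          exact ⟨i.succ, hi, hd⟩
    rw [gridWeight]
    simp only [hrow, hrest, ite_mul, zero_mul, Finset.sum_ite_eq', Finset.mem_univ, if_true]
    rw [ih _ _ _ (fun i j h => hμ (Fin.succ_lt_succ_iff.2 h))
      (fun i j h => ha (Fin.succ_lt_succ_iff.2 h)) (fun i => hK _), Fin.prod_univ_succ]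

end BaseCase

/-! ### Reduced words and the exchange condition. -/

section Words

variable {m : ℕ}

theorem wordPerm_cons (i : Fin m) (l : List (Fin m)) :
    wordPerm (i :: l) = simpleTransposition i * wordPerm l := by
  simp [wordPerm]

theorem simpleTransposition_mul_self (i : Fin m) :
    simpleTransposition i * simpleTransposition i = 1 := Equiv.swap_mul_self _ _

theorem simpleTransposition_inv (i : Fin m) : (simpleTransposition i)⁻¹ = simpleTransposition i :=
  Equiv.swap_inv _ _

/-- A simple transposition reverses the order of no pair but that of the two neighbours. -/
theorem simpleTransposition_lt {j : Fin m} {p q : Fin (m + 1)} (h : p < q)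
    (hne : ¬ (p = j.castSucc ∧ q = j.succ)) :
    simpleTransposition j p < simpleTransposition j q := by
  simp only [Fin.ext_iff, Fin.val_castSucc, Fin.val_succ] at hne
  simp only [simpleTransposition, Equiv.swap_apply_def, Fin.ext_iff, Fin.lt_def,
    Fin.val_castSucc, Fin.val_succ] at h ⊢
  split_ifs <;> try simp only [Fin.val_castSucc, Fin.val_succ]
  all_goals omega

/-- The exchange condition: a word that reverses the pair `p < q` loses one letter after
multiplication by the transposition of `p` and `q`. -/
theorem exists_shorter_word (l : List (Fin m)) {p q : Fin (m + 1)} (hpq : p < q)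
    (h : (wordPerm l)⁻¹ q < (wordPerm l)⁻¹ p) :
    ∃ l' : List (Fin m), l'.length < l.length ∧ wordPerm l' = Equiv.swap p q * wordPerm l := by
  induction l generalizing p q with
  | nil => simp [wordPerm] at h; omega
  | cons j l ih =>
    -- Either the first letter is the transposition of `p` and `q` and can be deleted, or it keeps
    -- `p` and `q` in order. Then the tail reverses their images, and conjugation by the letter
    -- carries the shortened tail back.
    by_cases hj : p = j.castSucc ∧ q = j.succ
    · obtain ⟨rfl, rfl⟩ := hj
      refine ⟨l, by simp, ?_⟩
      rw [wordPerm_cons, ← mul_assoc]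
      change _ = simpleTransposition j * simpleTransposition j * _
      rw [simpleTransposition_mul_self, one_mul]
    · rw [wordPerm_cons, mul_inv_rev, simpleTransposition_inv, Equiv.Perm.mul_apply,
        Equiv.Perm.mul_apply] at h
      obtain ⟨l', hl, hw⟩ := ih (simpleTransposition_lt hpq hj) h
      refine ⟨j :: l', by simpa using hl, ?_⟩
      rw [wordPerm_cons, hw, wordPerm_cons, ← mul_assoc, ← mul_assoc,
        Equiv.mul_swap_eq_swap_mul]
      have hs : ∀ k, simpleTransposition j (simpleTransposition j k) = k := fun k =>
        DFunLike.congr_fun (simpleTransposition_mul_self j) k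
      rw [hs, hs]

/-- A shorter spelling of the tail would shorten the whole word. If the tail already reversed the
two neighbours, the exchange condition would spell `w` with fewer letters than the tail has. -/
theorem IsReducedWord.of_cons {w : Equiv.Perm (Fin (m + 1))} {i : Fin m} {l : List (Fin m)}
    (h : IsReducedWord w (i :: l)) :
    IsReducedWord (wordPerm l) l ∧ (wordPerm l)⁻¹ i.castSucc < (wordPerm l)⁻¹ i.succ := by
  obtain ⟨rfl, hmin⟩ := h
  refine ⟨⟨rfl, fun l' hl' => ?_⟩, ?_⟩
  · have := hmin (i :: l') (by rw [wordPerm_cons, wordPerm_cons, hl'])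
    simpa using this
  · by_contra hlt
    have hne : (wordPerm l)⁻¹ i.castSucc ≠ (wordPerm l)⁻¹ i.succ :=
      fun h => (Fin.castSucc_lt_succ (i := i)).ne ((wordPerm l)⁻¹.injective h)
    obtain ⟨l', hl, hw⟩ := exists_shorter_word l (Fin.castSucc_lt_succ (i := i))
      (lt_of_le_of_ne (not_lt.1 hlt) hne.symm)
    have := hmin l' (by rw [hw, wordPerm_cons]; rfl)
    simp at this
    omega

end Words

/-! ### The recursion in `w` and the induction on reduced words. -/

section Main

open MvPolynomial

variable {R : Type*} [CommRing R] {m : ℕ}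

/-- The partition function of `𝔖_w^λ`, computed row by row. -/
theorem partitionFunction_systemBoundary (β α γ : R) (w : Equiv.Perm (Fin (m + 1)))
    (lam : Fin (m + 1) → ℕ) :
    partitionFunction (C β) (C α) (C γ) (fun i => (X i : MvPolynomial (Fin (m + 1)) R))
        (systemBoundary w lam) =
      gridWeight (C β) (C α) (C γ) (lam 0 + m + 1) (m + 1) X (fun i => some (w⁻¹ i).rev)
        (systemBoundary 1 lam).top :=
  -- The top boundary depends only on `λ`, so the one for `w = 1` serves for every `w`.
  partitionFunction_eq_gridWeight _ _ _ _ _ _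

theorem partitionFunction_one (β α γ : R) (lam : Fin (m + 1) → ℕ) (hlam : Antitone lam) :
    partitionFunction (C β) (C α) (C γ) (fun i => (X i : MvPolynomial (Fin (m + 1)) R))
        (systemBoundary 1 lam) = seedMonomial R lam := by
  have htop : (systemBoundary 1 lam).top =
      -- Indexed by the row that emits the color: row `i` emits color `i.rev`, placed in column
      -- `λ_{rev i} + i`.
      placement (lam 0 + m + 1) (fun i : Fin (m + 1) => lam i.rev + i) Fin.rev := by
    funext j
    ext d
    rw [mem_placement]
    simp only [systemBoundary, boundaryOf, Finset.mem_image, Finset.mem_filter, Finset.mem_univ,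
      true_and]
    constructor
    · rintro ⟨i, hi, rfl⟩
      exact ⟨i.rev, by simpa using hi, by simp⟩
    · rintro ⟨i, hi, rfl⟩
      exact ⟨i.rev, by simpa using hi, by simp⟩
  rw [partitionFunction_systemBoundary, htop]
  have hle : ∀ i, lam i ≤ lam 0 := fun i => hlam (Fin.zero_le i)
  refine (gridWeight_placement _ _ _ _ _ _ _ _ ?_ ?_ ?_).trans ?_
  · intro i j h
    have := hlam (Fin.rev_le_rev.2 h.le)
    have h' : (i : ℕ) < j := h
    simp only
    omega
  · exact fun i j h => Fin.rev_lt_rev.2 h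
  · intro i
    have := hle i.rev
    omega
  · refine Finset.prod_congr rfl fun i _ => ?_
    have := hle i.rev
    congr 1
    rw [Fin.val_rev]
    omega

theorem partitionFunction_simpleTransposition_mul (β α γ : R) (lam : Fin (m + 1) → ℕ)
    (w : Equiv.Perm (Fin (m + 1))) (i : Fin m) (hw : w⁻¹ i.castSucc < w⁻¹ i.succ) :
    partitionFunction (C β) (C α) (C γ) (fun i => (X i : MvPolynomial (Fin (m + 1)) R))
        (systemBoundary (simpleTransposition i * w) lam) =
      kirillovOp β α γ i (partitionFunction (C β) (C α) (C γ)
        (fun i => (X i : MvPolynomial (Fin (m + 1)) R)) (systemBoundary w lam)) := by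
  simp only [partitionFunction_systemBoundary]
  set a : Fin (m + 1) → Option (Fin (m + 1)) := fun i => some (w⁻¹ i).rev with ha
  have ha' : (fun k => some (((simpleTransposition i * w)⁻¹ k).rev)) =
      fun k => a (simpleTransposition i k) := by
    funext k
    rw [mul_inv_rev, simpleTransposition_inv, Equiv.Perm.mul_apply]
  rw [ha']
  set N := (systemBoundary (1 : Equiv.Perm (Fin (m + 1))) lam).top
  have hswap : swapVars i (gridWeight (C β) (C α) (C γ) (lam 0 + m + 1) (m + 1) X a N) =
      gridWeight (C β) (C α) (C γ) (lam 0 + m + 1) (m + 1)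
        (fun k => (X (simpleTransposition i k) : MvPolynomial (Fin (m + 1)) R)) a N := by
    have := map_gridWeight (rename (R := R) (simpleTransposition i)).toRingHom (C β) (C α) (C γ)
      (lam 0 + m + 1) (m + 1) X a N
    simpa [swapVars] using this
  have hex := gridWeight_exchange (C β) (C α) (C γ) (lam 0 + m + 1) i
    (X : Fin (m + 1) → MvPolynomial (Fin (m + 1)) R) a N
  rw [← hswap] at hex
  -- Left labels reverse `w⁻¹`, so the upper color is the larger. This selects the off-diagonal
  -- entry `y - x` rather than `α β (y - x)`, which would leave `α β` to be cancelled.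
  have hlt : (w⁻¹ i.succ).rev < (w⁻¹ i.castSucc).rev := Fin.rev_lt_rev.2 hw
  simp only [ha, rDiag, rSwap, if_neg hlt.ne', if_neg hlt.not_gt] at hex
  rw [← ha] at hex
  have hd := mul_dividedDifference i
    (gridWeight (C β) (C α) (C γ) (lam 0 + m + 1) (m + 1)
      (X : Fin (m + 1) → MvPolynomial (Fin (m + 1)) R) a N)
  apply isLeftRegular_X_sub_X i
  simp only [kirillovOp, C_add, C_mul]
  simp only [kirillovFactor, oplusOne] at hex
  generalize gridWeight (C β) (C α) (C γ) (lam 0 + m + 1) (m + 1)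
    (X : Fin (m + 1) → MvPolynomial (Fin (m + 1)) R) a N = Z at *
  -- The remaining identity is `kirillovFactor + β (y - x) = (1 + (α+γ) x)(1 + (β+γ) y)`.
  linear_combination (-1 : MvPolynomial (Fin (m + 1)) R) * hex -
    ((C α + C β + C γ) * X i.castSucc + C γ * X i.succ + 1 +
      (C β + C γ) * (C α + C γ) * X i.castSucc * X i.succ) * hd

theorem partitionFunction_eq_kirillovWordOp (β α γ : R) (lam : Fin (m + 1) → ℕ)
    (hlam : Antitone lam) (l : List (Fin m)) (w : Equiv.Perm (Fin (m + 1)))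
    (hl : IsReducedWord w l) :
    partitionFunction (C β) (C α) (C γ) (fun i => (X i : MvPolynomial (Fin (m + 1)) R))
        (systemBoundary w lam) = kirillovWordOp β α γ l (seedMonomial R lam) := by
  induction l generalizing w with
  | nil =>
    obtain rfl : 1 = w := by simpa [wordPerm] using hl.1
    exact partitionFunction_one β α γ lam hlam
  | cons i l ih =>
    obtain ⟨hl', hlt⟩ := hl.of_cons
    rw [← hl.1, wordPerm_cons, partitionFunction_simpleTransposition_mul β α γ lam _ i hlt,
      ih _ hl']
    rfl

end Main

end KirillovModel

theorem theorem2p2 {R : Type*} [CommRing R] (β α γ : R) (m : ℕ)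
    (lam : Fin (m + 1) → ℕ) (hlam : Antitone lam) (w : Equiv.Perm (Fin (m + 1))) :
    KirillovModel.partitionFunction (MvPolynomial.C β) (MvPolynomial.C α) (MvPolynomial.C γ)
        (fun i : Fin (m + 1) => (MvPolynomial.X i : MvPolynomial (Fin (m + 1)) R))
        (KirillovModel.systemBoundary w lam)
      = KirillovModel.twistedKirillov β α γ w lam ∧
    ∀ l : List (Fin m), KirillovModel.IsReducedWord w l →
      KirillovModel.twistedKirillov β α γ w lam
        = KirillovModel.kirillovWordOp β α γ l (KirillovModel.seedMonomial R lam) := by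
  have h := KirillovModel.partitionFunction_eq_kirillovWordOp β α γ lam hlam
  have h₀ := h _ w (KirillovModel.exists_isReducedWord w).choose_spec
  exact ⟨h₀, fun l hl => h₀.symm.trans (h l w hl)⟩
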